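/- Let $p(x)=\frac{\cosh(x-[x]-1/2)}{2\sinh(1/2)}$ for $x\in\mathbb{R}$, where $[x]$ is the integer part of $x$, and for $\beta\in\mathbb{R}$ let $w=p+\beta\,\partial_x p$. For real $b,\beta$ put $$J(b,\beta)=\inf\Big\{\int_0^1 w\Big(\tfrac b2u^2+\tfrac{3-b}{2}u_x^2\Big)\,dx\;:\;u\in H^1(0,1),\ u(0)=u(1)=1\Big\}\in[-\infty,\infty).$$ For $|\beta|\le\frac{e+1}{e-1}$ (so that $w>0$ on $(0,1)$) let $E_\beta$ be the space of $u\in L^1_{loc}(0,1)$ with $\|u\|_{E_\beta}^2=\int_0^1 w\,(u^2+u_x^2)\,dx<\infty$, where $u_x$ is the distributional derivative, and let $E_{\beta,0}$ be the closure of $C_c^\infty(0,1)$ in $E_\beta$. Then there is a least constant $C_\beta>0$ such that $$\int_0^1 w\,v^2\,dx\le C_\beta\int_0^1 w\,v_x^2\,dx\qquad\text{for all }v\in E_{\beta,0}.$$ For all real $b,\beta$: $J(b,\beta)>-\infty$ if and only if the following three conditions hold: 1. $|\beta|\le\frac{e+1}{e-1}$; 2. $b\le 3$; 3. $\frac{b}{3-b}>-\frac1{C_\beta}$,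 where this is understood to hold when $b=3$ (the left-hand side being $+\infty$). Moreover, if $|\beta|<\frac{e+1}{e-1}$, $b<3$ and $\frac{b}{3-b}>-\frac1{C_\beta}$, then the infimum defining $J(b,\beta)$ is attained. -/

import Mathlib

open MeasureTheory Set
open scoped ContDiff

noncomputable section

namespace BFamily

/-- The `1`-periodic kernel `p(x) = cosh(x - [x] - 1/2) / (2 sinh(1/2))`. -/
def kernel (x : ℝ) : ℝ :=
  Real.cosh (x - (⌊x⌋ : ℝ) - 1 / 2) / (2 * Real.sinh (1 / 2))

/-- The weight `w = p + β ∂ₓp`. The derivative is the pointwise one, which exists off the integers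
and agrees almost everywhere with the distributional derivative of `p`. -/
def weight (β x : ℝ) : ℝ :=
  kernel x + β * deriv kernel x

/-- `φ ∈ C_c^∞(0,1)`. -/
def IsTestFunction (φ : ℝ → ℝ) : Prop :=
  ContDiff ℝ ∞ φ ∧ HasCompactSupport φ ∧ tsupport φ ⊆ Ioo 0 1

/-- `u` and `g` are in `L^1_loc(0,1)`, and `g` is the distributional derivative of `u` on `(0,1)`. -/
def HasWeakDeriv (u g : ℝ → ℝ) : Prop :=
  LocallyIntegrableOn u (Ioo 0 1) ∧ LocallyIntegrableOn g (Ioo 0 1) ∧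
    ∀ φ : ℝ → ℝ, IsTestFunction φ →
      ∫ x in Ioo (0 : ℝ) 1, u x * deriv φ x = - ∫ x in Ioo (0 : ℝ) 1, g x * φ x

/-- `u ∈ H^1(0,1)` with distributional derivative `g`. -/
def MemH1 (u g : ℝ → ℝ) : Prop :=
  HasWeakDeriv u g ∧ MemLp u 2 (volume.restrict (Ioo 0 1)) ∧
    MemLp g 2 (volume.restrict (Ioo 0 1))

/-- `u ∈ H^1(0,1)` with distributional derivative `g` and boundary values `u(0) = u(1) = 1`;
`u` is the representative that is continuous on `[0,1]`, so that the boundary values are its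
values at the end points. -/
def Admissible (u g : ℝ → ℝ) : Prop :=
  MemH1 u g ∧ ContinuousOn u (Icc 0 1) ∧ u 0 = 1 ∧ u 1 = 1

/-- The functional `∫₀¹ w (b/2 u² + (3-b)/2 uₓ²) dx`, where `g` stands for `uₓ`. -/
def energy (b β : ℝ) (u g : ℝ → ℝ) : ℝ :=
  ∫ x in Ioo (0 : ℝ) 1, weight β x * (b / 2 * u x ^ 2 + (3 - b) / 2 * g x ^ 2)

/-- `J(b,β) ∈ [-∞, ∞]`, the infimum of the functional over the admissible functions. -/
def J (b β : ℝ) : EReal :=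
  sInf {t : EReal | ∃ u g : ℝ → ℝ, Admissible u g ∧ t = ((energy b β u g : ℝ) : EReal)}

/-- The square of the norm of `E_β`, where `g` stands for `uₓ`. -/
def normSqE (β : ℝ) (u g : ℝ → ℝ) : ℝ :=
  ∫ x in Ioo (0 : ℝ) 1, weight β x * (u x ^ 2 + g x ^ 2)

/-- `u ∈ E_β` with distributional derivative `g`
(used only for `|β| ≤ (e+1)/(e-1)`, where the weight is positive on `(0,1)`). -/
def MemE (β : ℝ) (u g : ℝ → ℝ) : Prop :=
  HasWeakDeriv u g ∧
    IntegrableOn (fun x => weight β x * (u x ^ 2 + g x ^ 2)) (Ioo 0 1)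

/-- `u ∈ E_{β,0}`, the closure of `C_c^∞(0,1)` in `E_β`, with distributional derivative `g`. -/
def MemE0 (β : ℝ) (u g : ℝ → ℝ) : Prop :=
  MemE β u g ∧ ∀ ε : ℝ, 0 < ε → ∃ φ : ℝ → ℝ, IsTestFunction φ ∧
    normSqE β (fun x => u x - φ x) (fun x => g x - deriv φ x) < ε

/-- The positive constants `C` for which `∫₀¹ w v² ≤ C ∫₀¹ w vₓ²` for all `v ∈ E_{β,0}`. -/
def poincareConstants (β : ℝ) : Set ℝ :=
  {C : ℝ | 0 < C ∧ ∀ v g : ℝ → ℝ, MemE0 β v g →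
    ∫ x in Ioo (0 : ℝ) 1, weight β x * v x ^ 2 ≤ C * ∫ x in Ioo (0 : ℝ) 1, weight β x * g x ^ 2}

/-- The best constant `C_β` in the weighted Poincaré inequality. -/
def poincareConst (β : ℝ) : ℝ :=
  sInf (poincareConstants β)

/-- The threshold `(e+1)/(e-1)`. -/
def betaMax : ℝ :=
  (Real.exp 1 + 1) / (Real.exp 1 - 1)

end BFamily

end

noncomputable section

namespace BFamily

/-! By `weight_eq` the weight on `(0,1)` is a combination of `sinh x` and `sinh (1 - x)` with
coefficients proportional to `betaMax + β` and `betaMax - β`, so it is positive there exactly when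
`|β| ≤ betaMax`. An admissible `u` equals `1 + ∫₀ˣ g` with `g ∈ L²` of mean zero
(`Admissible.eqOn`), and with `v = u - 1` the energy is a constant plus `b ∫ w v` plus `quadForm b β
v g` (`energy_one_add`).

Necessity. Along `1 + tφ` the energy is a quadratic polynomial in `t`, so boundedness below forces
`(b ∫ w φ)² ≤ K * quadForm` with `K` independent of `φ`
(`exists_sq_weightedIntegral_le_of_bot_lt_J`). In particular the form is nonnegative, and bumps on
short intervals then give conditions 1 and 2 (`exists_quadForm_neg`). Nonnegativity also gives the
weak form of condition 3. Equality there would make the Poincaré defect at the best constant control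
`(∫ w φ)²`. Nearly extremal functions, made nonnegative by a smoothed absolute value, refute this:
their mean would tend to zero, while `IsTestFunction.weightedSq_le_add` bounds `∫ w φ²` by a small
boundary term plus the mean (`not_forall_sq_weightedIntegral_le`).

Sufficiency. For `b < 3`, condition 3 makes the form coercive, and completing the square absorbs the
linear term (`exists_le_energy`). If moreover `|β| < betaMax`, the weight is bounded below on
`[0,1]`, the energy is uniformly convex in `g ∈ L²`, and minimizing sequences are Cauchy
(`exists_forall_le_of_midpoint`).

The best constant exists because the weight is monotone up to a factor 2, which yields the
inequality with constant 2 for test functions (`IsTestFunction.weightedSq_le`). -/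

/-! ### The weight: closed formula, sign and monotonicity up to a factor 2. -/

/-- The weight `w` on `[0, 1]`, as a combination of `sinh x` and `sinh (1 - x)`. -/
def smoothWeight (β x : ℝ) : ℝ :=
  ((betaMax + β) * Real.sinh x + (betaMax - β) * Real.sinh (1 - x)) / (2 * Real.sinh 1)

theorem sinh_half_pos : 0 < Real.sinh (1 / 2) := Real.sinh_pos_iff.2 (by norm_num)

theorem sinh_one_pos : 0 < Real.sinh 1 := Real.sinh_pos_iff.2 one_pos

theorem betaMax_eq : betaMax = Real.cosh (1 / 2) / Real.sinh (1 / 2) := by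
  have h : Real.exp 1 = Real.exp (1 / 2) * Real.exp (1 / 2) := by
    rw [← Real.exp_add]; norm_num
  have h1 : (1 : ℝ) < Real.exp (1 / 2) := Real.one_lt_exp_iff.2 (by norm_num)
  have h0 := Real.exp_pos (1 / 2)
  have hs := sinh_half_pos
  rw [Real.sinh_eq, Real.exp_neg] at hs
  rw [betaMax, Real.cosh_eq, Real.sinh_eq, Real.exp_neg, h]
  generalize Real.exp (1 / 2) = y at *
  have : y * y - 1 ≠ 0 := by nlinarith
  have : (y - y⁻¹) / 2 ≠ 0 := hs.ne'
  rw [div_eq_div_iff ‹_› this]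
  field_simp

theorem betaMax_pos : 0 < betaMax := by
  rw [betaMax_eq]
  exact div_pos (Real.cosh_pos _) sinh_half_pos

theorem smoothWeight_eq (β x : ℝ) : smoothWeight β x =
    (Real.cosh (x - 1 / 2) + β * Real.sinh (x - 1 / 2)) / (2 * Real.sinh (1 / 2)) := by
  have hs := sinh_half_pos
  have hc := Real.cosh_pos (1 / 2)
  have h1 : Real.sinh 1 = 2 * Real.sinh (1 / 2) * Real.cosh (1 / 2) := by
    rw [← Real.sinh_two_mul]; norm_num
  have h2 : Real.sinh x = Real.sinh (x - 1 / 2) * Real.cosh (1 / 2)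
      + Real.cosh (x - 1 / 2) * Real.sinh (1 / 2) := by
    rw [← Real.sinh_add]; congr 1; ring
  have h3 : Real.sinh (1 - x) = Real.sinh (1 / 2) * Real.cosh (x - 1 / 2)
      - Real.cosh (1 / 2) * Real.sinh (x - 1 / 2) := by
    rw [← Real.sinh_sub]; congr 1; ring
  rw [smoothWeight, h1, h2, h3, betaMax_eq]
  field_simp
  ring

theorem kernel_eqOn : EqOn kernel
    (fun x => Real.cosh (x - 1 / 2) / (2 * Real.sinh (1 / 2))) (Ioo 0 1) := by
  intro x hx
  have : ⌊x⌋ = 0 := Int.floor_eq_zero_iff.2 ⟨hx.1.le, hx.2⟩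
  simp [kernel, this]

theorem weight_eq {x : ℝ} (β : ℝ) (hx : x ∈ Ioo (0 : ℝ) 1) : weight β x = smoothWeight β x := by
  have hd : deriv kernel x = Real.sinh (x - 1 / 2) / (2 * Real.sinh (1 / 2)) := by
    rw [(kernel_eqOn.eventuallyEq_of_mem (isOpen_Ioo.mem_nhds hx)).deriv_eq]
    have := ((Real.hasDerivAt_cosh (x - 1 / 2)).comp x
      ((hasDerivAt_id x).sub_const (1 / 2))).div_const (2 * Real.sinh (1 / 2))
    exact (this.congr_deriv (by simp)).deriv
  rw [weight, hd, kernel_eqOn hx, smoothWeight_eq]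
  ring

@[fun_prop]
theorem continuous_smoothWeight (β : ℝ) : Continuous (smoothWeight β) := by
  unfold smoothWeight
  have := Real.continuous_sinh
  fun_prop

theorem smoothWeight_pos {β x : ℝ} (hβ : |β| ≤ betaMax) (hx : x ∈ Ioo (0 : ℝ) 1) :
    0 < smoothWeight β x := by
  obtain ⟨h1, h2⟩ := abs_le.1 hβ
  have hB := betaMax_pos
  have hx1 : 0 < Real.sinh x := Real.sinh_pos_iff.2 hx.1
  have hx2 : 0 < Real.sinh (1 - x) := Real.sinh_pos_iff.2 (by linarith [hx.2])
  apply div_pos _ (by linarith [sinh_one_pos])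
  rcases h2.lt_or_eq with h | h
  · have := mul_pos (sub_pos.2 h) hx2
    have := mul_nonneg (show 0 ≤ betaMax + β by linarith) hx1.le
    linarith
  · have := mul_pos (show 0 < betaMax + β by linarith) hx1
    rw [h] at this ⊢
    linarith

theorem smoothWeight_zero (β : ℝ) : smoothWeight β 0 = (betaMax - β) / 2 := by
  have := sinh_one_pos
  simp [smoothWeight]
  field_simp

theorem smoothWeight_one (β : ℝ) : smoothWeight β 1 = (betaMax + β) / 2 := by
  have := sinh_one_pos
  simp [smoothWeight]
  field_simp

theorem smoothWeight_nonneg {β x : ℝ} (hβ : |β| ≤ betaMax) (hx : x ∈ Icc (0 : ℝ) 1) :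
    0 ≤ smoothWeight β x := by
  obtain ⟨h1, h2⟩ := abs_le.1 hβ
  rcases eq_or_lt_of_le hx.1 with h | h
  · rw [← h, smoothWeight_zero]; linarith
  rcases eq_or_lt_of_le hx.2 with h' | h'
  · rw [h', smoothWeight_one]; linarith
  exact (smoothWeight_pos hβ ⟨h, h'⟩).le

theorem smoothWeight_pos_of_lt {β x : ℝ} (hβ : |β| < betaMax) (hx : x ∈ Icc (0 : ℝ) 1) :
    0 < smoothWeight β x := by
  obtain ⟨h1, h2⟩ := abs_lt.1 hβ
  rcases eq_or_lt_of_le hx.1 with h | h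
  · rw [← h, smoothWeight_zero]; linarith
  rcases eq_or_lt_of_le hx.2 with h' | h'
  · rw [h', smoothWeight_one]; linarith
  exact smoothWeight_pos hβ.le ⟨h, h'⟩

/-- One of the endpoint values `(betaMax ∓ β) / 2` is negative, and continuity carries the sign into
the open interval. -/
theorem exists_smoothWeight_lt_zero {β : ℝ} (hβ : betaMax < |β|) :
    ∃ c ∈ Ioo (0 : ℝ) 1, smoothWeight β c < 0 := by
  have key : ∃ x ∈ closure (Ioo (0 : ℝ) 1), smoothWeight β x < 0 := by
    rw [closure_Ioo zero_ne_one]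
    rcases lt_abs.1 hβ with h | h
    · exact ⟨0, by simp, by rw [smoothWeight_zero]; linarith⟩
    · exact ⟨1, by simp, by rw [smoothWeight_one]; linarith⟩
  obtain ⟨x, hx, hlt⟩ := key
  obtain ⟨y, hy1, hy2⟩ := mem_closure_iff.1 hx {y | smoothWeight β y < 0}
    (isOpen_lt (continuous_smoothWeight β) continuous_const) hlt
  exact ⟨y, hy2, hy1⟩

theorem exists_smoothWeight_pos (β : ℝ) : ∃ c ∈ Ioo (0 : ℝ) 1, 0 < smoothWeight β c := by
  refine ⟨1 / 2, by norm_num, ?_⟩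
  rw [smoothWeight_eq]
  have := sinh_half_pos
  simp only [sub_self, Real.cosh_zero, Real.sinh_zero, mul_zero, add_zero]
  positivity

theorem exists_abs_smoothWeight_le (β : ℝ) :
    ∃ M, 0 < M ∧ ∀ x ∈ Icc (0 : ℝ) 1, |smoothWeight β x| ≤ M := by
  obtain ⟨M, hM⟩ := isCompact_Icc.exists_bound_of_continuousOn
    (continuous_smoothWeight β).continuousOn
  exact ⟨max M 1, by positivity, fun x hx => (hM x hx).trans (le_max_left _ _)⟩

theorem exists_le_smoothWeight {β : ℝ} {s : Set ℝ} (hs : IsCompact s)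
    (h : ∀ x ∈ s, 0 < smoothWeight β x) : ∃ m, 0 < m ∧ ∀ x ∈ s, m ≤ smoothWeight β x := by
  rcases s.eq_empty_or_nonempty with rfl | hne
  · exact ⟨1, one_pos, by simp⟩
  obtain ⟨x, hx, hmin⟩ := hs.exists_isMinOn hne (continuous_smoothWeight β).continuousOn
  exact ⟨_, h x hx, fun y hy => hmin hy⟩

theorem sinh_add_sinh_one_sub (x : ℝ) : Real.sinh x + Real.sinh (1 - x) =
    2 * Real.sinh (1 / 2) * Real.cosh (x - 1 / 2) := by
  have h2 : Real.sinh x = Real.sinh (x - 1 / 2) * Real.cosh (1 / 2)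
      + Real.cosh (x - 1 / 2) * Real.sinh (1 / 2) := by
    rw [← Real.sinh_add]; congr 1; ring
  have h3 : Real.sinh (1 - x) = Real.sinh (1 / 2) * Real.cosh (x - 1 / 2)
      - Real.cosh (1 / 2) * Real.sinh (x - 1 / 2) := by
    rw [← Real.sinh_sub]; congr 1; ring
  rw [h2, h3]; ring

theorem cosh_half_le_two : Real.cosh (1 / 2) ≤ 2 := by
  have h1 : Real.exp (1 / 2) ≤ 3 :=
    (Real.exp_le_exp.2 (by norm_num)).trans Real.exp_one_lt_three.le
  have h2 : Real.exp (-(1 / 2)) ≤ 1 := Real.exp_le_one_iff.2 (by norm_num)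
  rw [Real.cosh_eq]
  linarith

/-- The sum is a positive multiple of `cosh (x - 1/2)`, which is at least 1 everywhere and at most
`cosh (1/2) ≤ 2` on `[0,1]`. -/
theorem sinh_add_sinh_one_sub_le {x : ℝ} (hx : x ∈ Icc (0 : ℝ) 1) (y : ℝ) :
    Real.sinh x + Real.sinh (1 - x) ≤ 2 * (Real.sinh y + Real.sinh (1 - y)) := by
  rw [sinh_add_sinh_one_sub, sinh_add_sinh_one_sub]
  have h1 : Real.cosh (x - 1 / 2) ≤ Real.cosh (1 / 2) := by
    rw [Real.cosh_le_cosh, abs_le, abs_of_pos (by norm_num : (0 : ℝ) < 1 / 2)]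
    constructor <;> linarith [hx.1, hx.2]
  have h2 := Real.one_le_cosh (y - 1 / 2)
  have h3 := cosh_half_le_two
  have h4 := sinh_half_pos
  nlinarith

theorem smoothWeight_neg (β x : ℝ) : smoothWeight (-β) x = smoothWeight β (1 - x) := by
  simp only [smoothWeight, sub_sub_cancel]; ring

/-- For `β ≥ 0` the weight is an increasing multiple of `sinh` plus a nonnegative multiple of a
function that varies by at most a factor 2. This substitute for monotonicity survives when the
weight vanishes at 0. -/
theorem smoothWeight_le_two_mul_right {β x y : ℝ} (h0 : 0 ≤ β) (hβ : |β| ≤ betaMax)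
    (hx : 0 ≤ x) (hxy : x ≤ y) (hy : y ≤ 1) : smoothWeight β x ≤ 2 * smoothWeight β y := by
  obtain ⟨h1, h2⟩ := abs_le.1 hβ
  have hs := sinh_one_pos
  have e (z : ℝ) : smoothWeight β z = (2 * β * Real.sinh z
      + (betaMax - β) * (Real.sinh z + Real.sinh (1 - z))) / (2 * Real.sinh 1) := by
    rw [smoothWeight]; ring
  rw [e, e, ← mul_div_assoc]
  apply div_le_div_of_nonneg_right _ (by positivity)
  have a1 := mul_le_mul_of_nonneg_left
    (sinh_add_sinh_one_sub_le (x := x) ⟨hx, hxy.trans hy⟩ y) (sub_nonneg.2 h2)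
  have a2 := mul_le_mul_of_nonneg_left (Real.sinh_le_sinh.2 hxy) h0
  have a3 := mul_nonneg h0 (Real.sinh_nonneg_iff.2 (hx.trans hxy))
  linarith

theorem smoothWeight_le_two_mul_left {β x y : ℝ} (h0 : β ≤ 0) (hβ : |β| ≤ betaMax)
    (hy : 0 ≤ y) (hyx : y ≤ x) (hx : x ≤ 1) : smoothWeight β x ≤ 2 * smoothWeight β y := by
  have := smoothWeight_le_two_mul_right (β := -β) (x := 1 - x) (y := 1 - y) (by linarith)
    (by rwa [abs_neg]) (by linarith) (by linarith) (by linarith)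
  simpa only [smoothWeight_neg, sub_sub_cancel] using this

/-! ### Weighted integrals and primitives of `L²` functions. -/

/-- Lebesgue measure on `(0, 1)`. -/
abbrev unitMeasure : Measure ℝ := volume.restrict (Ioo 0 1)

theorem unitMeasure_real_univ : unitMeasure.real univ = 1 := by
  simp [unitMeasure, measureReal_def]

/-- `∫₀¹ w f²`. -/
def weightedSq (β : ℝ) (f : ℝ → ℝ) : ℝ :=
  ∫ x in Ioo (0 : ℝ) 1, smoothWeight β x * f x ^ 2

/-- The primitive `x ↦ ∫₀ˣ g`. -/
def prim (g : ℝ → ℝ) (x : ℝ) : ℝ := ∫ t in (0 : ℝ)..x, g t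

theorem integrable_smoothWeight_mul {f : ℝ → ℝ} (β : ℝ) (hf : Integrable f unitMeasure) :
    Integrable (fun x => smoothWeight β x * f x) unitMeasure := by
  obtain ⟨M, -, hM⟩ := exists_abs_smoothWeight_le β
  refine hf.bdd_mul (c := M) (continuous_smoothWeight β).aestronglyMeasurable ?_
  exact ae_restrict_of_forall_mem measurableSet_Ioo fun x hx => hM x (Ioo_subset_Icc_self hx)

theorem integrable_smoothWeight_mul_sq {f : ℝ → ℝ} (β : ℝ) (hf : MemLp f 2 unitMeasure) :
    Integrable (fun x => smoothWeight β x * f x ^ 2) unitMeasure :=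
  integrable_smoothWeight_mul β hf.integrable_sq

theorem energy_eq {u g : ℝ → ℝ} (b β : ℝ) (hu : MemLp u 2 unitMeasure)
    (hg : MemLp g 2 unitMeasure) :
    energy b β u g = b / 2 * weightedSq β u + (3 - b) / 2 * weightedSq β g := by
  rw [weightedSq, weightedSq, ← integral_const_mul, ← integral_const_mul, ← integral_add
    ((integrable_smoothWeight_mul_sq β hu).const_mul _)
    ((integrable_smoothWeight_mul_sq β hg).const_mul _), energy]
  refine setIntegral_congr_fun measurableSet_Ioo fun x hx => ?_
  simp only [weight_eq β hx]
  ring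

theorem weightedSq_nonneg {β : ℝ} (hβ : |β| ≤ betaMax) (f : ℝ → ℝ) : 0 ≤ weightedSq β f :=
  setIntegral_nonneg measurableSet_Ioo fun _ hx =>
    mul_nonneg (smoothWeight_pos hβ hx).le (sq_nonneg _)

theorem weightedSq_const_mul (β t : ℝ) (f : ℝ → ℝ) :
    weightedSq β (fun x => t * f x) = t ^ 2 * weightedSq β f := by
  rw [weightedSq, weightedSq, ← integral_const_mul]
  congr 1 with x
  ring

theorem weightedSq_congr {f h : ℝ → ℝ} (β : ℝ) (H : EqOn f h (Ioo 0 1)) :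
    weightedSq β f = weightedSq β h :=
  setIntegral_congr_fun measurableSet_Ioo fun x hx => by simp only [H hx]

theorem weightedSq_one_add {f : ℝ → ℝ} (β : ℝ) (hf : MemLp f 2 unitMeasure) :
    weightedSq β (fun x => 1 + f x) = weightedSq β (fun _ => 1)
      + 2 * (∫ x in Ioo (0 : ℝ) 1, smoothWeight β x * f x) + weightedSq β f := by
  have h1 := integrable_smoothWeight_mul β (hf.integrable one_le_two)
  have h2 := integrable_smoothWeight_mul_sq β hf
  have h3 := integrable_smoothWeight_mul_sq β (memLp_const (μ := unitMeasure) (p := 2) (1 : ℝ))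
  have h4 : Integrable (fun x => smoothWeight β x * 1 ^ 2 + 2 * (smoothWeight β x * f x))
    unitMeasure := h3.add (h1.const_mul 2)
  rw [weightedSq, weightedSq, weightedSq, ← integral_const_mul,
    ← integral_add h3 (h1.const_mul 2), ← integral_add h4 h2]
  congr 1 with x
  ring

/-- Cauchy–Schwarz against the constant 1, obtained by expanding `∫ (|g| - a)² ≥ 0`, where `a` is
the integral of `|g|`. -/
theorem sq_integral_abs_le {α : Type*} [MeasurableSpace α] {ν : Measure α} [IsFiniteMeasure ν]
    (hν : ν.real univ ≤ 1) {g : α → ℝ} (hg : MemLp g 2 ν) :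
    (∫ x, |g x| ∂ν) ^ 2 ≤ ∫ x, g x ^ 2 ∂ν := by
  set a := ∫ x, |g x| ∂ν with ha
  have h1 : Integrable (fun x => |g x|) ν := (hg.integrable one_le_two).abs
  have h2 : Integrable (fun x => g x ^ 2) ν := hg.integrable_sq
  have h0 : 0 ≤ ∫ x, (g x ^ 2 - 2 * a * |g x| + a ^ 2) ∂ν := by
    refine integral_nonneg fun x => ?_
    have := sq_nonneg (|g x| - a)
    have e := sq_abs (g x)
    simp only [Pi.zero_apply]
    nlinarith
  have h3 : Integrable (fun x => g x ^ 2 - 2 * a * |g x|) ν := h2.sub (h1.const_mul _)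
  rw [integral_add h3 (integrable_const _),
    integral_sub h2 (h1.const_mul _), integral_const_mul, integral_const, smul_eq_mul, ← ha] at h0
  nlinarith [mul_le_mul_of_nonneg_right hν (sq_nonneg a)]

theorem sq_intervalIntegral_le {g : ℝ → ℝ} (hg : MemLp g 2 unitMeasure) {x y : ℝ} (hx : 0 ≤ x)
    (hxy : x ≤ y) (hy : y ≤ 1) : (∫ t in x..y, g t) ^ 2 ≤ ∫ t in Ioo x y, g t ^ 2 := by
  have hg' : MemLp g 2 (volume.restrict (Ioo x y)) :=
    hg.mono_measure (Measure.restrict_mono (Ioo_subset_Ioo hx hy) le_rfl)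
  have hm : (volume.restrict (Ioo x y)).real univ ≤ 1 := by
    simp [measureReal_def, ENNReal.toReal_ofReal, hxy]
    linarith
  refine le_trans ?_ (sq_integral_abs_le hm hg')
  rw [intervalIntegral.integral_of_le hxy, integral_Ioc_eq_integral_Ioo, ← sq_abs]
  gcongr
  exact abs_integral_le_integral_abs

theorem prim_sq_le {g : ℝ → ℝ} (hg : MemLp g 2 unitMeasure) {x : ℝ} (hx : x ∈ Icc (0 : ℝ) 1) :
    prim g x ^ 2 ≤ ∫ t in Ioo 0 1, g t ^ 2 := by
  refine (sq_intervalIntegral_le hg le_rfl hx.1 hx.2).trans ?_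
  exact setIntegral_mono_set hg.integrable_sq (ae_of_all _ fun _ => sq_nonneg _)
    (Ioo_subset_Ioo_right hx.2).eventuallyLE

theorem intervalIntegrable_of_memLp {g : ℝ → ℝ} (hg : MemLp g 2 unitMeasure) :
    IntervalIntegrable g volume 0 1 :=
  (intervalIntegrable_iff_integrableOn_Ioo_of_le zero_le_one).2 (hg.integrable one_le_two)

theorem absolutelyContinuous_prim {g : ℝ → ℝ} (hg : MemLp g 2 unitMeasure) :
    AbsolutelyContinuousOnInterval (prim g) 0 1 :=
  (intervalIntegrable_of_memLp hg).absolutelyContinuousOnInterval_intervalIntegral (by simp)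

theorem continuousOn_prim {g : ℝ → ℝ} (hg : MemLp g 2 unitMeasure) :
    ContinuousOn (prim g) (Icc 0 1) := by
  simpa [uIcc_of_le] using (absolutelyContinuous_prim hg).continuousOn

theorem ContinuousOn.memLp_unit {f : ℝ → ℝ} (hf : ContinuousOn f (Icc 0 1)) :
    MemLp f 2 unitMeasure := by
  obtain ⟨M, hM⟩ := isCompact_Icc.exists_bound_of_continuousOn hf
  exact MemLp.of_bound ((hf.mono Ioo_subset_Icc_self).aestronglyMeasurable measurableSet_Ioo) M
    (ae_restrict_of_forall_mem measurableSet_Ioo fun x hx => hM x (Ioo_subset_Icc_self hx))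

theorem memLp_prim {g : ℝ → ℝ} (hg : MemLp g 2 unitMeasure) : MemLp (prim g) 2 unitMeasure :=
  ContinuousOn.memLp_unit (continuousOn_prim hg)

/-! ### Test functions on `(0,1)`. -/

namespace IsTestFunction

variable {φ ψ : ℝ → ℝ}

theorem contDiff (h : IsTestFunction φ) : ContDiff ℝ ∞ φ := h.1

theorem continuous (h : IsTestFunction φ) : Continuous φ := h.1.continuous

theorem differentiable (h : IsTestFunction φ) : Differentiable ℝ φ :=
  h.1.differentiable (by simp)

theorem deriv (h : IsTestFunction φ) : IsTestFunction (deriv φ) :=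
  ⟨(contDiff_infty_iff_deriv.1 h.1).2, h.2.1.deriv, (tsupport_deriv_subset).trans h.2.2⟩

theorem memLp (h : IsTestFunction φ) : MemLp φ 2 unitMeasure :=
  ContinuousOn.memLp_unit h.continuous.continuousOn

theorem eq_zero (h : IsTestFunction φ) {x : ℝ} (hx : x ∉ Ioo (0 : ℝ) 1) : φ x = 0 :=
  image_eq_zero_of_notMem_tsupport fun h' => hx (h.2.2 h')

theorem const_mul (h : IsTestFunction φ) (t : ℝ) : IsTestFunction (fun x => t * φ x) :=
  ⟨contDiff_const.mul h.1, h.2.1.mul_left,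
    (tsupport_mul_subset_right (f := fun _ => t) (g := φ)).trans h.2.2⟩

theorem add (h : IsTestFunction φ) (h' : IsTestFunction ψ) :
    IsTestFunction (fun x => φ x + ψ x) :=
  ⟨h.1.add h'.1, h.2.1.add h'.2.1, (tsupport_add φ ψ).trans (union_subset h.2.2 h'.2.2)⟩

theorem zero : IsTestFunction (fun _ => 0) :=
  ⟨contDiff_const, HasCompactSupport.zero, by simp [tsupport]⟩

theorem of_support_subset (h : ContDiff ℝ ∞ φ) {a b : ℝ} (ha : 0 < a) (hb : b < 1)
    (hs : Function.support φ ⊆ Icc a b) : IsTestFunction φ := by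
  have hts : tsupport φ ⊆ Icc a b := closure_minimal hs isClosed_Icc
  exact ⟨h, isCompact_Icc.of_isClosed_subset (isClosed_tsupport φ) hts,
    hts.trans (Icc_subset_Ioo ha hb)⟩

theorem exists_support_subset (h : IsTestFunction φ) :
    ∃ a b, 0 < a ∧ a ≤ b ∧ b < 1 ∧ Function.support φ ⊆ Icc a b := by
  rcases (tsupport φ).eq_empty_or_nonempty with he | hne
  · refine ⟨1 / 2, 1 / 2, by norm_num, le_rfl, by norm_num, ?_⟩
    exact (subset_tsupport φ).trans (by simp [he])
  · have hc : IsCompact (tsupport φ) := h.2.1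
    refine ⟨sInf (tsupport φ), sSup (tsupport φ), (h.2.2 (hc.sInf_mem hne)).1,
      csInf_le hc.bddBelow (hc.sSup_mem hne), (h.2.2 (hc.sSup_mem hne)).2, fun x hx => ?_⟩
    have hx' := subset_tsupport φ hx
    exact ⟨csInf_le hc.bddBelow hx', le_csSup hc.bddAbove hx'⟩

theorem integral_deriv (h : IsTestFunction φ) (x y : ℝ) :
    ∫ t in x..y, _root_.deriv φ t = φ y - φ x :=
  intervalIntegral.integral_deriv_eq_sub (fun t _ => h.differentiable t)
    (h.deriv.continuous.intervalIntegrable _ _)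

theorem prim_deriv (h : IsTestFunction φ) : prim (_root_.deriv φ) = φ := by
  funext x
  rw [prim, h.integral_deriv, h.eq_zero (x := 0) (by simp), sub_zero]

theorem hasDerivAt_prim (h : IsTestFunction φ) (x : ℝ) : HasDerivAt (prim φ) (φ x) x :=
  intervalIntegral.integral_hasDerivAt_right (h.continuous.intervalIntegrable _ _)
    (h.continuous.stronglyMeasurableAtFilter _ _) h.continuous.continuousAt

theorem deriv_prim (h : IsTestFunction φ) : _root_.deriv (prim φ) = φ :=
  funext fun x => (h.hasDerivAt_prim x).deriv

theorem isTestFunction_prim (h : IsTestFunction φ) (h0 : ∫ t in (0 : ℝ)..1, φ t = 0) :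
    IsTestFunction (prim φ) := by
  obtain ⟨a, b, ha, hab, hb, hs⟩ := h.exists_support_subset
  -- Only the open interval `(a, b)` has to be avoided: the support lies in `[a, b]` and its
  -- endpoints are null.
  have hz : ∀ x y, (∀ t ∈ uIoc x y, t ∉ Ioo a b) → ∀ᵐ t, t ∈ uIoc x y → φ t = 0 := by
    intro x y hxy
    have hab' : ∀ᵐ t : ℝ, t ≠ a ∧ t ≠ b :=
      (Measure.ae_ne volume a).and (Measure.ae_ne volume b)
    filter_upwards [hab'] with t ht htxy
    by_contra hne
    obtain ⟨h1, h2⟩ := hs hne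
    exact hxy t htxy ⟨lt_of_le_of_ne h1 ht.1.symm, lt_of_le_of_ne h2 ht.2⟩
  refine of_support_subset (a := a) (b := b) ?_ ha hb ?_
  · refine contDiff_infty_iff_deriv.2 ⟨fun x => (h.hasDerivAt_prim x).differentiableAt, ?_⟩
    rw [h.deriv_prim]
    exact h.1
  · intro x hx
    by_contra hne
    apply hx
    rcases not_and_or.1 hne with h' | h'
    · refine intervalIntegral.integral_zero_ae (hz _ _ fun t ht hta => ?_)
      have := ht.2
      rcases max_choice 0 x with e | e <;> rw [e] at this <;> linarith [hta.1]
    · have e : prim φ x + ∫ t in x..1, φ t = 0 := by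
        rw [prim, intervalIntegral.integral_add_adjacent_intervals
          (h.continuous.intervalIntegrable _ _) (h.continuous.intervalIntegrable _ _), h0]
      rw [intervalIntegral.integral_zero_ae (hz _ _ fun t ht hta => ?_), add_zero] at e
      · exact e
      · have := ht.1
        rcases min_choice x 1 with e | e <;> rw [e] at this <;> linarith [hta.2]

end IsTestFunction

/-! ### Du Bois-Reymond lemma; admissible functions as primitives. -/

theorem exists_isTestFunction_integral_eq_one :
    ∃ ψ, IsTestFunction ψ ∧ ∫ t in (0 : ℝ)..1, ψ t = 1 := by
  let f : ContDiffBump (1 / 2 : ℝ) := ⟨1 / 8, 1 / 4, by norm_num, by norm_num⟩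
  have hs : Function.support (f.normed volume) ⊆ Icc (1 / 4) (3 / 4) := by
    rw [f.support_normed_eq, Real.ball_eq_Ioo]
    refine Ioo_subset_Icc_self.trans (Icc_subset_Icc ?_ ?_) <;> norm_num [f]
  refine ⟨f.normed volume, IsTestFunction.of_support_subset f.contDiff_normed (a := 1 / 4)
    (b := 3 / 4) (by norm_num) (by norm_num) hs, ?_⟩
  rw [intervalIntegral.integral_eq_integral_of_support_subset, f.integral_normed]
  exact fun x hx => ⟨by linarith [(hs hx).1], by linarith [(hs hx).2]⟩

theorem setIntegral_unit_eq (f : ℝ → ℝ) :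
    ∫ x in Ioo (0 : ℝ) 1, f x = ∫ x in (0 : ℝ)..1, f x := by
  rw [intervalIntegral.integral_of_le zero_le_one, integral_Ioc_eq_integral_Ioo]

/-- The du Bois-Reymond lemma on `(0, 1)`. -/
theorem exists_ae_eq_const_of_integral_mul_deriv {f : ℝ → ℝ} (hf : Integrable f unitMeasure)
    (h : ∀ φ, IsTestFunction φ → ∫ x in Ioo (0 : ℝ) 1, f x * deriv φ x = 0) :
    ∃ c, ∀ᵐ x, x ∈ Ioo (0 : ℝ) 1 → f x = c := by
  obtain ⟨ψ, hψ, hψ1⟩ := exists_isTestFunction_integral_eq_one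
  have hint : ∀ {η}, IsTestFunction η → Integrable (fun x => f x * η x) unitMeasure := by
    intro η hη
    obtain ⟨M, hM⟩ := hη.2.1.exists_bound_of_continuous hη.continuous
    exact hf.mul_bdd (c := M) hη.continuous.aestronglyMeasurable (ae_of_all _ hM)
  refine ⟨∫ x in Ioo (0 : ℝ) 1, f x * ψ x, ?_⟩
  set c := ∫ x in Ioo (0 : ℝ) 1, f x * ψ x with hc
  have key := isOpen_Ioo.ae_eq_zero_of_integral_contDiff_smul_eq_zero (U := Ioo (0 : ℝ) 1)
    (f := fun x => f x - c) (μ := volume) ?_ ?_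
  · filter_upwards [key] with x hx hxI using sub_eq_zero.1 (hx hxI)
  · have : IntegrableOn (fun x => f x - c) (Ioo 0 1) := Integrable.sub hf (integrable_const c)
    exact this.locallyIntegrableOn
  · intro η h1 h2 h3
    have hη : IsTestFunction η := ⟨h1, h2, h3⟩
    -- Subtracting `m ψ` gives `η` mean zero, so its primitive is again a test function and the
    -- hypothesis applies to it.
    set m := ∫ t in (0 : ℝ)..1, η t with hm
    have hζ : IsTestFunction (fun x => η x + (-m) * ψ x) := hη.add (hψ.const_mul _)
    have hζ0 : ∫ t in (0 : ℝ)..1, (η t + (-m) * ψ t) = 0 := by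
      rw [intervalIntegral.integral_add (hη.continuous.intervalIntegrable _ _)
        ((hψ.const_mul _).continuous.intervalIntegrable _ _),
        intervalIntegral.integral_const_mul, hψ1, ← hm]
      ring
    have e := h _ (hζ.isTestFunction_prim hζ0)
    rw [hζ.deriv_prim] at e
    have e1 : ∫ x in Ioo (0 : ℝ) 1, f x * (η x + (-m) * ψ x)
        = (∫ x in Ioo (0 : ℝ) 1, f x * η x) - m * c := by
      rw [hc, ← integral_const_mul, ← integral_sub (hint hη) ((hint hψ).const_mul _)]
      congr 1 with x
      ring
    have e2 : ∫ x, η x • (f x - c) = ∫ x in Ioo (0 : ℝ) 1, (f x * η x - c * η x) := by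
      rw [← setIntegral_eq_integral_of_forall_compl_eq_zero (s := Ioo (0 : ℝ) 1)]
      · congr 1 with x
        simp only [smul_eq_mul]; ring
      · intro x hx
        rw [hη.eq_zero hx, zero_smul]
    rw [e2, integral_sub (hint hη) ((hη.memLp.integrable one_le_two).const_mul c),
      integral_const_mul, setIntegral_unit_eq η, ← hm]
    linarith

/-- Integration by parts for absolutely continuous functions; the boundary terms vanish with `φ`. -/
theorem hasWeakDeriv_const_add_prim {g : ℝ → ℝ} (hg : MemLp g 2 unitMeasure) (c : ℝ) :
    HasWeakDeriv (fun x => c + prim g x) g := by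
  have hu : MemLp (fun x => c + prim g x) 2 unitMeasure := (memLp_const c).add (memLp_prim hg)
  refine ⟨IntegrableOn.locallyIntegrableOn (hu.integrable one_le_two),
    IntegrableOn.locallyIntegrableOn (hg.integrable one_le_two), fun φ hφ => ?_⟩
  have hφac : AbsolutelyContinuousOnInterval φ 0 1 := by
    have := absolutelyContinuous_prim hφ.deriv.memLp
    rwa [hφ.prim_deriv] at this
  have hp := (absolutelyContinuous_prim hg).integral_mul_deriv_eq_deriv_mul hφac
  rw [hφ.eq_zero (x := 0) (by simp), hφ.eq_zero (x := 1) (by simp)] at hp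
  have hd : ∫ x in (0 : ℝ)..1, deriv (prim g) x * φ x = ∫ x in (0 : ℝ)..1, g x * φ x := by
    refine intervalIntegral.integral_congr_ae ?_
    filter_upwards [(intervalIntegrable_of_memLp hg).ae_hasDerivAt_integral] with x hx hx'
    rw [(hx (uIoc_subset_uIcc hx') 0 (by simp)).deriv (f := prim g)]
  have hc : ∫ x in (0 : ℝ)..1, c * deriv φ x = 0 := by
    rw [intervalIntegral.integral_const_mul, hφ.integral_deriv, hφ.eq_zero (x := 0) (by simp),
      hφ.eq_zero (x := 1) (by simp)]
    simp
  have hφc := hφ.deriv.continuous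
  rw [setIntegral_unit_eq, setIntegral_unit_eq, ← hd]
  simp only [add_mul]
  rw [intervalIntegral.integral_add, hp, hc]
  · ring
  · exact (continuous_const.mul hφc).intervalIntegrable _ _
  · refine ContinuousOn.intervalIntegrable ?_
    rw [uIcc_of_le zero_le_one]
    exact (continuousOn_prim hg).mul hφc.continuousOn

theorem IsTestFunction.hasWeakDeriv {φ : ℝ → ℝ} (hφ : IsTestFunction φ) :
    HasWeakDeriv φ (_root_.deriv φ) := by
  have := hasWeakDeriv_const_add_prim hφ.deriv.memLp 0
  simp only [hφ.prim_deriv, zero_add] at this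
  exact this

theorem admissible_one_add_prim {g : ℝ → ℝ} (hg : MemLp g 2 unitMeasure)
    (h0 : ∫ t in (0 : ℝ)..1, g t = 0) : Admissible (fun x => 1 + prim g x) g := by
  have hu : MemLp (fun x => 1 + prim g x) 2 unitMeasure := (memLp_const (1 : ℝ)).add (memLp_prim hg)
  refine ⟨⟨hasWeakDeriv_const_add_prim hg 1, hu, hg⟩, continuousOn_const.add (continuousOn_prim hg),
    by simp [prim], by simp [prim, h0]⟩

theorem Admissible.memLp_deriv {u g : ℝ → ℝ} (h : Admissible u g) : MemLp g 2 unitMeasure :=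
  h.1.2.2

/-- The difference `u - prim g` has zero weak derivative, hence is a.e. constant. Continuity extends
this to all of `[0,1]`, and the value at 0 fixes the constant. -/
theorem Admissible.eqOn {u g : ℝ → ℝ} (h : Admissible u g) :
    EqOn u (fun x => 1 + prim g x) (Icc 0 1) := by
  obtain ⟨⟨⟨-, -, hw⟩, hu, hg⟩, hc, h0, -⟩ := h
  have hp := memLp_prim hg
  have hcont : ContinuousOn (fun x => u x - prim g x) (Icc 0 1) := hc.sub (continuousOn_prim hg)
  obtain ⟨c, hcc⟩ := exists_ae_eq_const_of_integral_mul_deriv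
    (f := fun x => u x - prim g x) ((hu.sub hp).integrable one_le_two) (by
      intro φ hφ
      have h1 := hw φ hφ
      have h2 := (hasWeakDeriv_const_add_prim hg 0).2.2 φ hφ
      simp only [zero_add] at h2
      have hd := hφ.deriv.memLp
      have hud : Integrable (fun x => u x * deriv φ x) unitMeasure := hu.integrable_mul hd
      have hpd : Integrable (fun x => prim g x * deriv φ x) unitMeasure := hp.integrable_mul hd
      simp only [sub_mul]
      rw [integral_sub hud hpd, h1, h2, sub_self])
  have hI : EqOn (fun x => u x - prim g x) (fun _ => c) (Ioo 0 1) := by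
    refine Measure.eqOn_of_ae_eq (μ := volume) ?_ (hcont.mono Ioo_subset_Icc_self)
      continuousOn_const ?_
    · exact (ae_restrict_iff' measurableSet_Ioo).2 hcc
    · rw [interior_Ioo]
      exact subset_closure
  have hI' : EqOn (fun x => u x - prim g x) (fun _ => c) (Icc 0 1) :=
    hI.of_subset_closure hcont continuousOn_const Ioo_subset_Icc_self (by
      rw [closure_Ioo zero_ne_one])
  have hc1 : c = 1 := by
    have := hI' (left_mem_Icc.2 zero_le_one)
    simpa [prim, h0] using this.symm
  intro x hx
  have := hI' hx
  simp only [hc1] at this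
  linarith

theorem Admissible.integral_deriv_eq_zero {u g : ℝ → ℝ} (h : Admissible u g) :
    ∫ t in (0 : ℝ)..1, g t = 0 := by
  have := h.eqOn (right_mem_Icc.2 zero_le_one)
  rw [h.2.2.2] at this
  simpa [prim] using this

theorem Admissible.energy_eq {u g : ℝ → ℝ} (h : Admissible u g) (b β : ℝ) :
    energy b β u g = energy b β (fun x => 1 + prim g x) g :=
  setIntegral_congr_fun measurableSet_Ioo fun x hx => by
    simp only [h.eqOn (Ioo_subset_Icc_self hx)]

/-! ### The weighted Poincaré inequality and its best constant. -/

theorem le_apply_zero_of_forall_pos {F : ℝ → ℝ} (hF : ContinuousAt F 0) {a : ℝ}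
    (h : ∀ ε, 0 < ε → a ≤ F ε) : a ≤ F 0 :=
  ge_of_tendsto (hF.tendsto.mono_left (nhdsWithin_le_nhds (s := Ioi 0)))
    (eventually_mem_nhdsWithin.mono fun ε hε => h ε hε)

theorem IsTestFunction.sq_le_integral_right {φ : ℝ → ℝ} (hφ : IsTestFunction φ) {x : ℝ}
    (hx : x ∈ Icc (0 : ℝ) 1) : φ x ^ 2 ≤ ∫ t in Ioo x 1, _root_.deriv φ t ^ 2 := by
  have := sq_intervalIntegral_le hφ.deriv.memLp hx.1 hx.2 le_rfl
  rwa [hφ.integral_deriv, hφ.eq_zero (x := 1) (by simp), zero_sub, neg_sq] at this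

theorem IsTestFunction.sq_le_integral_left {φ : ℝ → ℝ} (hφ : IsTestFunction φ) {x : ℝ}
    (hx : x ∈ Icc (0 : ℝ) 1) : φ x ^ 2 ≤ ∫ t in Ioo 0 x, _root_.deriv φ t ^ 2 := by
  have := sq_intervalIntegral_le hφ.deriv.memLp le_rfl hx.1 hx.2
  rwa [hφ.integral_deriv, hφ.eq_zero (x := 0) (by simp), sub_zero] at this

theorem smoothWeight_mul_setIntegral_sq_le {β x : ℝ} (hβ : |β| ≤ betaMax)
    (hx : x ∈ Icc (0 : ℝ) 1) {s : Set ℝ} (hs : MeasurableSet s) (hs' : s ⊆ Ioo 0 1)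
    (h : ∀ y ∈ s, smoothWeight β x ≤ 2 * smoothWeight β y) {f : ℝ → ℝ}
    (hf : MemLp f 2 unitMeasure) {a : ℝ} (ha : a ≤ ∫ t in s, f t ^ 2) :
    smoothWeight β x * a ≤ 2 * weightedSq β f := by
  have hi := integrable_smoothWeight_mul_sq β hf
  have hf2 : IntegrableOn (fun t => f t ^ 2) s := IntegrableOn.mono_set hf.integrable_sq hs'
  calc smoothWeight β x * a ≤ smoothWeight β x * ∫ t in s, f t ^ 2 :=
        mul_le_mul_of_nonneg_left ha (smoothWeight_nonneg hβ hx)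
    _ = ∫ t in s, smoothWeight β x * f t ^ 2 := (integral_const_mul _ _).symm
    _ ≤ ∫ t in s, 2 * (smoothWeight β t * f t ^ 2) := by
        refine setIntegral_mono_on (hf2.const_mul _) ((IntegrableOn.mono_set hi hs').const_mul 2)
          hs fun t ht => ?_
        rw [← mul_assoc]
        exact mul_le_mul_of_nonneg_right (h t ht) (sq_nonneg _)
    _ = 2 * ∫ t in s, smoothWeight β t * f t ^ 2 := integral_const_mul _ _
    _ ≤ 2 * weightedSq β f := by
        refine mul_le_mul_of_nonneg_left (setIntegral_mono_set hi ?_ hs'.eventuallyLE) zero_le_two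
        exact ae_restrict_of_forall_mem measurableSet_Ioo fun t ht =>
          mul_nonneg (smoothWeight_pos hβ ht).le (sq_nonneg _)

/-- Write `φ x` as an integral of `φ'` towards the endpoint where the weight is larger (1 if `β ≥
0`, 0 if `β ≤ 0`). Along that path the weight is at least half of its value at `x`, so it can be
moved under the integral. -/
theorem IsTestFunction.smoothWeight_mul_sq_le {β x : ℝ} {φ : ℝ → ℝ} (hφ : IsTestFunction φ)
    (hβ : |β| ≤ betaMax) (hx : x ∈ Icc (0 : ℝ) 1) :
    smoothWeight β x * φ x ^ 2 ≤ 2 * weightedSq β (_root_.deriv φ) := by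
  rcases le_total 0 β with h0 | h0
  · exact smoothWeight_mul_setIntegral_sq_le hβ hx measurableSet_Ioo
      (Ioo_subset_Ioo_left hx.1)
      (fun y hy => smoothWeight_le_two_mul_right h0 hβ hx.1 hy.1.le hy.2.le) hφ.deriv.memLp
      (hφ.sq_le_integral_right hx)
  · exact smoothWeight_mul_setIntegral_sq_le hβ hx measurableSet_Ioo
      (Ioo_subset_Ioo_right hx.2)
      (fun y hy => smoothWeight_le_two_mul_left h0 hβ hy.1.le hy.2.le hx.2) hφ.deriv.memLp
      (hφ.sq_le_integral_left hx)

theorem IsTestFunction.weightedSq_le {β : ℝ} {φ : ℝ → ℝ} (hφ : IsTestFunction φ)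
    (hβ : |β| ≤ betaMax) : weightedSq β φ ≤ 2 * weightedSq β (_root_.deriv φ) := by
  have h := setIntegral_mono_on (integrable_smoothWeight_mul_sq β hφ.memLp)
    (integrable_const (2 * weightedSq β (_root_.deriv φ))) measurableSet_Ioo
    fun x hx => hφ.smoothWeight_mul_sq_le hβ (Ioo_subset_Icc_self hx)
  rwa [integral_const, unitMeasure_real_univ, one_smul] at h

/-- `∫₀¹ w f²` is finite. -/
def FiniteWeightedSq (β : ℝ) (f : ℝ → ℝ) : Prop :=
  AEStronglyMeasurable f unitMeasure ∧
    Integrable (fun x => smoothWeight β x * f x ^ 2) unitMeasure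

theorem FiniteWeightedSq.of_memLp {β : ℝ} {f : ℝ → ℝ} (hf : MemLp f 2 unitMeasure) :
    FiniteWeightedSq β f :=
  ⟨hf.1, integrable_smoothWeight_mul_sq β hf⟩

theorem FiniteWeightedSq.of_le {β : ℝ} {f F : ℝ → ℝ} (hβ : |β| ≤ betaMax)
    (hf : AEStronglyMeasurable f unitMeasure) (hF : Integrable F unitMeasure)
    (h : ∀ x ∈ Ioo (0 : ℝ) 1, smoothWeight β x * f x ^ 2 ≤ F x) : FiniteWeightedSq β f := by
  refine ⟨hf, hF.mono' ?_ ?_⟩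
  · exact (continuous_smoothWeight β).aestronglyMeasurable.mul (hf.pow 2)
  · refine ae_restrict_of_forall_mem measurableSet_Ioo fun x hx => ?_
    rw [Real.norm_eq_abs, abs_of_nonneg (mul_nonneg (smoothWeight_pos hβ hx).le (sq_nonneg _))]
    exact h x hx

theorem FiniteWeightedSq.sub {β : ℝ} {f h : ℝ → ℝ} (hβ : |β| ≤ betaMax)
    (hf : FiniteWeightedSq β f) (hh : FiniteWeightedSq β h) :
    FiniteWeightedSq β (fun x => f x - h x) := by
  refine .of_le hβ (hf.1.sub hh.1) ((hf.2.const_mul 2).add (hh.2.const_mul 2)) fun x hx => ?_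
  have := mul_nonneg (smoothWeight_pos hβ hx).le (sq_nonneg (f x + h x))
  simp only [Pi.add_apply]
  nlinarith

theorem weightedSq_le_young {β η : ℝ} {f h : ℝ → ℝ} (hβ : |β| ≤ betaMax) (hη : 0 < η)
    (hf : FiniteWeightedSq β f) (hh : FiniteWeightedSq β h) :
    weightedSq β f ≤ (1 + η) * weightedSq β h
      + (1 + 1 / η) * weightedSq β (fun x => f x - h x) := by
  have hd := (hf.sub hβ hh).2
  rw [weightedSq, weightedSq, weightedSq, ← integral_const_mul, ← integral_const_mul,
    ← integral_add (hh.2.const_mul _) (hd.const_mul _)]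
  refine setIntegral_mono_on hf.2 ((hh.2.const_mul _).add (hd.const_mul _)) measurableSet_Ioo
    fun x hx => ?_
  have e : (1 + η) * (smoothWeight β x * h x ^ 2)
      + (1 + 1 / η) * (smoothWeight β x * (f x - h x) ^ 2) - smoothWeight β x * f x ^ 2
      = smoothWeight β x * (η * (h x - (f x - h x) / η) ^ 2) := by
    field_simp
    ring
  have := mul_nonneg (smoothWeight_pos hβ hx).le
    (mul_nonneg hη.le (sq_nonneg (h x - (f x - h x) / η)))
  linarith

theorem setIntegral_weight_mul_sq (β : ℝ) (f : ℝ → ℝ) :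
    ∫ x in Ioo (0 : ℝ) 1, weight β x * f x ^ 2 = weightedSq β f :=
  setIntegral_congr_fun measurableSet_Ioo fun x hx => by simp only [weight_eq β hx]

theorem normSqE_eq {β : ℝ} {u g : ℝ → ℝ} (hu : FiniteWeightedSq β u)
    (hg : FiniteWeightedSq β g) : normSqE β u g = weightedSq β u + weightedSq β g := by
  rw [weightedSq, weightedSq, ← integral_add hu.2 hg.2]
  refine setIntegral_congr_fun measurableSet_Ioo fun x hx => ?_
  simp only [weight_eq β hx]
  ring

/-- At `|β| = betaMax` the weight vanishes at an endpoint and members of `E_β` need not be in `L²`,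
so the two halves of the norm are tracked separately. Each is dominated by the sum because the
weight is positive. -/
theorem memE_iff {β : ℝ} {u g : ℝ → ℝ} (hβ : |β| ≤ betaMax) :
    MemE β u g ↔ HasWeakDeriv u g ∧ FiniteWeightedSq β u ∧ FiniteWeightedSq β g := by
  have hcongr : EqOn (fun x => weight β x * (u x ^ 2 + g x ^ 2))
      (fun x => smoothWeight β x * u x ^ 2 + smoothWeight β x * g x ^ 2) (Ioo 0 1) :=
    fun x hx => by simp only [weight_eq β hx]; ring
  rw [MemE, integrableOn_congr_fun hcongr measurableSet_Ioo]
  refine and_congr_right fun hw => ⟨fun hi => ?_, fun ⟨hu, hg⟩ => hu.2.add hg.2⟩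
  refine ⟨.of_le hβ hw.1.aestronglyMeasurable hi fun x hx => ?_,
    .of_le hβ hw.2.1.aestronglyMeasurable hi fun x hx => ?_⟩
  · linarith [mul_nonneg (smoothWeight_pos hβ hx).le (sq_nonneg (g x))]
  · linarith [mul_nonneg (smoothWeight_pos hβ hx).le (sq_nonneg (u x))]

theorem IsTestFunction.memE0 {β : ℝ} {φ : ℝ → ℝ} (hφ : IsTestFunction φ) (hβ : |β| ≤ betaMax) :
    MemE0 β φ (_root_.deriv φ) :=
  ⟨(memE_iff hβ).2 ⟨hφ.hasWeakDeriv, .of_memLp hφ.memLp, .of_memLp hφ.deriv.memLp⟩,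
    fun ε hε => ⟨φ, hφ, by simpa [normSqE] using hε⟩⟩

/-- Young's inequality with parameter `η` compares `v` and `g` with `φ` and `φ'`. Letting `ε → 0`
for fixed `η`, and then `η → 0`, passes to the closure without loss in the constant. -/
theorem weightedSq_le_of_memE0 {β C : ℝ} (hβ : |β| ≤ betaMax) (hC : 0 ≤ C)
    (h : ∀ φ, IsTestFunction φ → weightedSq β φ ≤ C * weightedSq β (deriv φ))
    {v g : ℝ → ℝ} (hv : MemE0 β v g) : weightedSq β v ≤ C * weightedSq β g := by
  obtain ⟨-, fv, fg⟩ := (memE_iff hβ).1 hv.1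
  have key : ∀ η, 0 < η → ∀ ε, 0 < ε → weightedSq β v ≤
      (1 + η) * (C * ((1 + η) * weightedSq β g + (1 + 1 / η) * ε)) + (1 + 1 / η) * ε := by
    intro η hη ε hε
    obtain ⟨φ, hφ, hlt⟩ := hv.2 ε hε
    have fφ : FiniteWeightedSq β φ := .of_memLp hφ.memLp
    have fφ' : FiniteWeightedSq β (deriv φ) := .of_memLp hφ.deriv.memLp
    rw [normSqE_eq (fv.sub hβ fφ) (fg.sub hβ fφ')] at hlt
    have n1 := weightedSq_nonneg hβ (fun x => v x - φ x)
    have n2 := weightedSq_nonneg hβ (fun x => g x - deriv φ x)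
    have y1 := weightedSq_le_young hβ hη fv fφ
    have y2 := weightedSq_le_young hβ hη fφ' fg
    have e : weightedSq β (fun x => deriv φ x - g x) = weightedSq β (fun x => g x - deriv φ x) := by
      simp only [weightedSq, sub_sq_comm (deriv φ _)]
    rw [e] at y2
    have hη' : 0 ≤ 1 + 1 / η := by positivity
    calc weightedSq β v ≤ (1 + η) * weightedSq β φ + (1 + 1 / η) * ε := by
          refine y1.trans ?_
          gcongr
          linarith
      _ ≤ _ := by
          gcongr
          refine (h φ hφ).trans ?_
          gcongr
          refine y2.trans ?_
          gcongr
          linarith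
  have key2 : ∀ η, 0 < η → weightedSq β v ≤ (1 + η) * (C * ((1 + η) * weightedSq β g)) := by
    intro η hη
    have := le_apply_zero_of_forall_pos (F := fun ε =>
      (1 + η) * (C * ((1 + η) * weightedSq β g + (1 + 1 / η) * ε)) + (1 + 1 / η) * ε)
      (by fun_prop) (key η hη)
    simpa using this
  have := le_apply_zero_of_forall_pos (F := fun η =>
    (1 + η) * (C * ((1 + η) * weightedSq β g))) (by fun_prop) key2
  simpa using this

theorem mem_poincareConstants_iff {β C : ℝ} (hβ : |β| ≤ betaMax) :
    C ∈ poincareConstants β ↔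
      0 < C ∧ ∀ φ, IsTestFunction φ → weightedSq β φ ≤ C * weightedSq β (deriv φ) := by
  simp only [poincareConstants, mem_ofPred_eq, setIntegral_weight_mul_sq]
  exact and_congr_right fun hC => ⟨fun h φ hφ => h _ _ (hφ.memE0 hβ),
    fun h v g hv => weightedSq_le_of_memE0 hβ hC.le h hv⟩

theorem exists_isTestFunction_support_subset {a b : ℝ} (ha : 0 < a) (hab : a < b) (hb : b < 1) :
    ∃ φ, IsTestFunction φ ∧ Function.support φ = Ioo a b ∧ ∀ x, 0 ≤ φ x := by
  let f : ContDiffBump ((a + b) / 2) :=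
    ⟨(b - a) / 4, (b - a) / 2, by linarith, by linarith⟩
  have hs : Function.support f = Ioo a b := by
    rw [f.support_eq, Real.ball_eq_Ioo]
    congr 1 <;> simp only [f] <;> ring
  exact ⟨f, .of_support_subset f.contDiff ha hb (hs ▸ Ioo_subset_Icc_self), hs,
    fun x => f.nonneg⟩

theorem weightedSq_pos {β : ℝ} {f : ℝ → ℝ} {a b : ℝ} (hβ : |β| ≤ betaMax) (ha : 0 ≤ a)
    (hab : a < b) (hb : b ≤ 1) (hf : MemLp f 2 unitMeasure) (h : ∀ x ∈ Ioo a b, f x ≠ 0) :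
    0 < weightedSq β f := by
  have hI := Ioo_subset_Ioo ha hb
  have hn : 0 ≤ᵐ[unitMeasure] fun x => smoothWeight β x * f x ^ 2 :=
    ae_restrict_of_forall_mem measurableSet_Ioo fun x hx =>
      mul_nonneg (smoothWeight_pos hβ hx).le (sq_nonneg _)
  rw [weightedSq, setIntegral_pos_iff_support_of_nonneg_ae hn (integrable_smoothWeight_mul_sq β hf)]
  refine lt_of_lt_of_le (b := volume (Ioo a b)) (by simp [hab]) (measure_mono fun x hx => ?_)
  exact ⟨(mul_pos (smoothWeight_pos hβ (hI hx)) (pow_pos (abs_pos.2 (h x hx)) 2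
    |>.trans_eq (sq_abs _))).ne', hI hx⟩

/-- For each `φ` the inequality is a closed condition on `C`, so it passes to the infimum. A fixed
bump has a positive quotient, which keeps the infimum away from 0. -/
theorem isLeast_poincareConst {β : ℝ} (hβ : |β| ≤ betaMax) :
    IsLeast (poincareConstants β) (poincareConst β) := by
  have hne : (2 : ℝ) ∈ poincareConstants β :=
    (mem_poincareConstants_iff hβ).2 ⟨two_pos, fun φ hφ => hφ.weightedSq_le hβ⟩
  have hbdd : BddBelow (poincareConstants β) := ⟨0, fun C hC => hC.1.le⟩
  refine ⟨(mem_poincareConstants_iff hβ).2 ⟨?_, fun φ hφ => ?_⟩, fun C hC => csInf_le hbdd hC⟩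
  · obtain ⟨φ, hφ, hs, -⟩ := exists_isTestFunction_support_subset (a := 1 / 4) (b := 3 / 4)
      (by norm_num) (by norm_num) (by norm_num)
    have h0 : 0 < weightedSq β φ := weightedSq_pos (a := 1 / 4) (b := 3 / 4) hβ (by norm_num)
      (by norm_num) (by norm_num) hφ.memLp fun x hx => by rwa [← Function.mem_support, hs]
    have h1 : 0 < weightedSq β (deriv φ) := by linarith [hφ.weightedSq_le hβ]
    refine lt_of_lt_of_le (div_pos h0 h1) (le_csInf ⟨2, hne⟩ fun C hC => ?_)
    rw [div_le_iff₀ h1]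
    exact ((mem_poincareConstants_iff hβ).1 hC).2 φ hφ
  · rcases (weightedSq_nonneg hβ (deriv φ)).eq_or_lt with h0 | h0
    · have := hφ.weightedSq_le hβ
      rw [← h0] at this ⊢
      simpa using this
    · rw [← div_le_iff₀ h0]
      refine le_csInf ⟨2, hne⟩ fun C hC => ?_
      rw [div_le_iff₀ h0]
      exact ((mem_poincareConstants_iff hβ).1 hC).2 φ hφ

theorem poincareConst_pos {β : ℝ} (hβ : |β| ≤ betaMax) : 0 < poincareConst β :=
  (isLeast_poincareConst hβ).1.1

/-! ### Density: mean-zero `L²` functions are limits of derivatives of test functions. -/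

theorem norm_sq_eq_integral (F : Lp ℝ 2 unitMeasure) :
    ‖F‖ ^ 2 = ∫ x in Ioo (0 : ℝ) 1, F x ^ 2 := by
  rw [← real_inner_self_eq_norm_sq, L2.inner_def]
  congr 1 with x
  simp [pow_two]

/-- The classes in `L²(0, 1)` of the derivatives of test functions. -/
def testDerivs : Submodule ℝ (Lp ℝ 2 unitMeasure) where
  carrier := {F | ∃ φ, IsTestFunction φ ∧ F =ᵐ[unitMeasure] deriv φ}
  zero_mem' := ⟨_, .zero, by rw [deriv_const']; exact Lp.coeFn_zero ℝ 2 unitMeasure⟩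
  add_mem' := by
    rintro F G ⟨φ, hφ, hF⟩ ⟨ψ, hψ, hG⟩
    refine ⟨_, hφ.add hψ, ?_⟩
    filter_upwards [Lp.coeFn_add F G, hF, hG] with x h1 h2 h3
    rw [h1, Pi.add_apply, h2, h3, deriv_fun_add (hφ.differentiable x) (hψ.differentiable x)]
  smul_mem' := by
    rintro c F ⟨φ, hφ, hF⟩
    refine ⟨_, hφ.const_mul c, ?_⟩
    filter_upwards [Lp.coeFn_smul c F, hF] with x h1 h2
    rw [h1, Pi.smul_apply, h2, deriv_const_mul _ (hφ.differentiable x), smul_eq_mul]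

/-- The closure is the double orthogonal complement. By du Bois-Reymond the orthogonal complement of
`testDerivs` consists of constants, to which a mean-zero `g` is orthogonal. -/
theorem toLp_mem_closure_testDerivs {g : ℝ → ℝ} (hg : MemLp g 2 unitMeasure)
    (h0 : ∫ t in (0 : ℝ)..1, g t = 0) : hg.toLp g ∈ testDerivs.topologicalClosure := by
  rw [← Submodule.orthogonal_orthogonal_eq_closure, Submodule.mem_orthogonal]
  intro F hF
  obtain ⟨c, hc⟩ := exists_ae_eq_const_of_integral_mul_deriv
    ((Lp.memLp F).integrable one_le_two) (by
      intro φ hφ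
      have := (Submodule.mem_orthogonal _ _).1 hF (hφ.deriv.memLp.toLp _)
        ⟨φ, hφ, MemLp.coeFn_toLp _⟩
      rw [L2.inner_def] at this
      refine (integral_congr_ae ?_).trans this
      filter_upwards [hφ.deriv.memLp.coeFn_toLp] with x hx
      simp [hx])
  rw [L2.inner_def]
  have : ∫ x in Ioo (0 : ℝ) 1, c * g x = 0 := by
    rw [integral_const_mul, setIntegral_unit_eq, h0, mul_zero]
  refine (integral_congr_ae ?_).trans this
  filter_upwards [hg.coeFn_toLp, (ae_restrict_iff' measurableSet_Ioo).2 hc] with x hx hx'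
  simp [hx, hx', mul_comm]

theorem exists_isTestFunction_integral_sub_deriv_sq_lt {g : ℝ → ℝ} (hg : MemLp g 2 unitMeasure)
    (h0 : ∫ t in (0 : ℝ)..1, g t = 0) {ε : ℝ} (hε : 0 < ε) :
    ∃ φ, IsTestFunction φ ∧ ∫ x in Ioo (0 : ℝ) 1, (g x - deriv φ x) ^ 2 < ε := by
  obtain ⟨F, ⟨φ, hφ, hF⟩, hd⟩ := Metric.mem_closure_iff.1
    (show hg.toLp g ∈ closure (testDerivs : Set (Lp ℝ 2 unitMeasure)) from
      toLp_mem_closure_testDerivs hg h0) (√ε) (Real.sqrt_pos.2 hε)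
  refine ⟨φ, hφ, ?_⟩
  rw [dist_eq_norm, Real.lt_sqrt (norm_nonneg _), norm_sq_eq_integral] at hd
  refine lt_of_eq_of_lt (integral_congr_ae ?_) hd
  filter_upwards [Lp.coeFn_sub (hg.toLp g) F, hF, hg.coeFn_toLp] with x h1 h2 h3
  rw [h1, Pi.sub_apply, h2, h3]

theorem weightedSq_le_mul_integral_sq {β M : ℝ} (hM : ∀ x ∈ Icc (0 : ℝ) 1, |smoothWeight β x| ≤ M)
    {f : ℝ → ℝ} (hf : MemLp f 2 unitMeasure) :
    |weightedSq β f| ≤ M * ∫ x in Ioo (0 : ℝ) 1, f x ^ 2 := by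
  rw [← integral_const_mul]
  refine (abs_integral_le_integral_abs).trans (setIntegral_mono_on
    (integrable_smoothWeight_mul_sq β hf).abs (hf.integrable_sq.const_mul M) measurableSet_Ioo
    fun x hx => ?_)
  rw [abs_mul, abs_of_nonneg (sq_nonneg (f x))]
  exact mul_le_mul_of_nonneg_right (hM x (Ioo_subset_Icc_self hx)) (sq_nonneg _)

theorem prim_sub {f g : ℝ → ℝ} (hf : MemLp f 2 unitMeasure) (hg : MemLp g 2 unitMeasure) {x : ℝ}
    (hx : x ∈ Icc (0 : ℝ) 1) : prim f x - prim g x = prim (fun t => f t - g t) x := by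
  have hs : uIcc 0 x ⊆ uIcc (0 : ℝ) 1 := by
    rw [uIcc_of_le hx.1, uIcc_of_le zero_le_one]
    exact Icc_subset_Icc_right hx.2
  exact (intervalIntegral.integral_sub ((intervalIntegrable_of_memLp hf).mono_set hs)
    ((intervalIntegrable_of_memLp hg).mono_set hs)).symm

theorem integral_prim_sq_le {g : ℝ → ℝ} (hg : MemLp g 2 unitMeasure) :
    ∫ x in Ioo (0 : ℝ) 1, prim g x ^ 2 ≤ ∫ x in Ioo (0 : ℝ) 1, g x ^ 2 := by
  have := setIntegral_mono_on (memLp_prim hg).integrable_sq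
    (integrable_const (∫ x in Ioo (0 : ℝ) 1, g x ^ 2)) measurableSet_Ioo
    fun x hx => prim_sq_le hg (Ioo_subset_Icc_self hx)
  rwa [integral_const, unitMeasure_real_univ, one_smul] at this

/-- The weight is bounded, so `L²` approximation of `g` by `φ'` controls the `E_β` norm, and the
primitives are controlled by their derivatives. This brings the best constant to bear on every
admissible `u - 1`. -/
theorem memE0_prim {β : ℝ} (hβ : |β| ≤ betaMax) {g : ℝ → ℝ} (hg : MemLp g 2 unitMeasure)
    (h0 : ∫ t in (0 : ℝ)..1, g t = 0) : MemE0 β (prim g) g := by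
  have hw := hasWeakDeriv_const_add_prim hg 0
  simp only [zero_add] at hw
  refine ⟨(memE_iff hβ).2 ⟨hw, .of_memLp (memLp_prim hg), .of_memLp hg⟩, fun ε hε => ?_⟩
  obtain ⟨M, hM0, hM⟩ := exists_abs_smoothWeight_le β
  obtain ⟨φ, hφ, hlt⟩ := exists_isTestFunction_integral_sub_deriv_sq_lt hg h0
    (ε := ε / (2 * M)) (by positivity)
  refine ⟨φ, hφ, ?_⟩
  have hd : MemLp (fun x => g x - deriv φ x) 2 unitMeasure := hg.sub hφ.deriv.memLp
  have e : EqOn (fun x => prim g x - φ x) (prim fun x => g x - deriv φ x) (Ioo 0 1) := by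
    intro x hx
    rw [← prim_sub hg hφ.deriv.memLp (Ioo_subset_Icc_self hx), hφ.prim_deriv]
  have hp : MemLp (fun x => prim g x - φ x) 2 unitMeasure := (memLp_prim hg).sub hφ.memLp
  rw [normSqE_eq (.of_memLp hp) (.of_memLp hd), weightedSq_congr β e]
  have h1 := (le_abs_self _).trans (weightedSq_le_mul_integral_sq hM hd)
  have h2 := (le_abs_self _).trans (weightedSq_le_mul_integral_sq hM (memLp_prim hd))
  have h3 := mul_le_mul_of_nonneg_left (integral_prim_sq_le hd) hM0.le
  have h4 := mul_lt_mul_of_pos_left hlt (by positivity : 0 < 2 * M)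
  have h5 : 2 * M * (ε / (2 * M)) = ε := by field_simp
  linarith

theorem weightedSq_prim_le {β : ℝ} (hβ : |β| ≤ betaMax) {g : ℝ → ℝ} (hg : MemLp g 2 unitMeasure)
    (h0 : ∫ t in (0 : ℝ)..1, g t = 0) :
    weightedSq β (prim g) ≤ poincareConst β * weightedSq β g := by
  have := (isLeast_poincareConst hβ).1.2 _ _ (memE0_prim hβ hg h0)
  simpa only [setIntegral_weight_mul_sq] using this

/-! ### Necessity of `|β| ≤ betaMax` and `b ≤ 3`. -/

/-- The quadratic part of the functional. -/
def quadForm (b β : ℝ) (v g : ℝ → ℝ) : ℝ :=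
  b / 2 * weightedSq β v + (3 - b) / 2 * weightedSq β g

/-- `∫₀¹ w f`. -/
def weightedIntegral (β : ℝ) (f : ℝ → ℝ) : ℝ :=
  ∫ x in Ioo (0 : ℝ) 1, smoothWeight β x * f x

theorem energy_one_add {v g : ℝ → ℝ} (b β : ℝ) (hv : MemLp v 2 unitMeasure)
    (hg : MemLp g 2 unitMeasure) : energy b β (fun x => 1 + v x) g =
      b / 2 * weightedSq β (fun _ => 1) + b * weightedIntegral β v + quadForm b β v g := by
  have h1 : MemLp (fun x => 1 + v x) 2 unitMeasure := (memLp_const (1 : ℝ)).add hv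
  rw [energy_eq b β h1 hg, weightedSq_one_add β hv, quadForm, weightedIntegral]
  ring

theorem IsTestFunction.admissible_one_add {φ : ℝ → ℝ} (hφ : IsTestFunction φ) :
    Admissible (fun x => 1 + φ x) (_root_.deriv φ) := by
  have := admissible_one_add_prim hφ.deriv.memLp (by
    rw [hφ.integral_deriv, hφ.eq_zero (x := 0) (by simp), hφ.eq_zero (x := 1) (by simp), sub_zero])
  rwa [hφ.prim_deriv] at this

theorem bot_lt_J_iff {b β : ℝ} :
    ⊥ < J b β ↔ ∃ m : ℝ, ∀ u g, Admissible u g → m ≤ energy b β u g := by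
  constructor
  · intro h
    obtain ⟨m, -, hm⟩ := EReal.lt_iff_exists_real_btwn.1 h
    exact ⟨m, fun u g hug => EReal.coe_le_coe_iff.1 (hm.le.trans (sInf_le ⟨u, g, hug, rfl⟩))⟩
  · rintro ⟨m, hm⟩
    refine (EReal.bot_lt_coe m).trans_le (le_sInf ?_)
    rintro _ ⟨u, g, hug, rfl⟩
    exact EReal.coe_le_coe_iff.2 (hm u g hug)

theorem quadForm_const_mul (b β t : ℝ) (v g : ℝ → ℝ) :
    quadForm b β (fun x => t * v x) (fun x => t * g x) = t ^ 2 * quadForm b β v g := by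
  rw [quadForm, quadForm, weightedSq_const_mul, weightedSq_const_mul]
  ring

theorem exists_sq_weightedIntegral_le_of_bot_lt_J {b β : ℝ} (h : ⊥ < J b β) :
    ∃ K, 0 < K ∧ ∀ φ, IsTestFunction φ →
      (b * weightedIntegral β φ) ^ 2 ≤ K * quadForm b β φ (deriv φ) := by
  obtain ⟨m, hm⟩ := bot_lt_J_iff.1 h
  have key : ∀ φ, IsTestFunction φ → ∀ t, 0 ≤ quadForm b β φ (deriv φ) * (t * t)
      + b * weightedIntegral β φ * t + (b / 2 * weightedSq β (fun _ => 1) - m) := by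
    intro φ hφ t
    have ht := hφ.const_mul t
    have hd : deriv (fun x => t * φ x) = fun x => t * deriv φ x :=
      funext fun x => deriv_const_mul t (hφ.differentiable x)
    have hi : weightedIntegral β (fun x => t * φ x) = t * weightedIntegral β φ := by
      rw [weightedIntegral, weightedIntegral, ← integral_const_mul]
      congr 1 with x
      ring
    have := hm _ _ ht.admissible_one_add
    rw [energy_one_add b β ht.memLp ht.deriv.memLp, hd, quadForm_const_mul, hi] at this
    linarith
  have h0 : 0 ≤ b / 2 * weightedSq β (fun _ => 1) - m := by
    simpa using key _ IsTestFunction.zero 0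
  -- The discriminant of the polynomial in `t` is nonpositive. Raising the constant term by 1 keeps
  -- the polynomial nonnegative and makes `K` strictly positive.
  refine ⟨4 * (b / 2 * weightedSq β (fun _ => 1) - m + 1), by linarith, fun φ hφ => ?_⟩
  have := discrim_le_zero (a := quadForm b β φ (deriv φ)) (b := b * weightedIntegral β φ)
    (c := b / 2 * weightedSq β (fun _ => 1) - m + 1) fun t => by linarith [key φ hφ t]
  rw [discrim] at this
  linarith

theorem quadForm_nonneg_of_bot_lt_J {b β : ℝ} (h : ⊥ < J b β) {φ : ℝ → ℝ}
    (hφ : IsTestFunction φ) : 0 ≤ quadForm b β φ (deriv φ) := by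
  obtain ⟨K, hK, hle⟩ := exists_sq_weightedIntegral_le_of_bot_lt_J h
  exact nonneg_of_mul_nonneg_right ((sq_nonneg _).trans (hle φ hφ)) hK

theorem integral_sq_pos {f : ℝ → ℝ} {a d : ℝ} (ha : 0 ≤ a) (hab : a < d) (hb : d ≤ 1)
    (hf : MemLp f 2 unitMeasure) (h : ∀ x ∈ Ioo a d, f x ≠ 0) :
    0 < ∫ x in Ioo (0 : ℝ) 1, f x ^ 2 := by
  obtain ⟨M, hM0, hM⟩ := exists_abs_smoothWeight_le 0
  have h1 := weightedSq_pos (β := 0) (by simpa using betaMax_pos.le) ha hab hb hf h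
  have h2 := (le_abs_self _).trans (weightedSq_le_mul_integral_sq hM hf)
  exact pos_of_mul_pos_right (h1.trans_le h2) hM0.le

theorem weightedSq_mul_le {β k m : ℝ} {f : ℝ → ℝ} (hf : MemLp f 2 unitMeasure)
    (h : ∀ x ∈ Ioo (0 : ℝ) 1, f x ≠ 0 → k * smoothWeight β x ≤ m) :
    k * weightedSq β f ≤ m * ∫ x in Ioo (0 : ℝ) 1, f x ^ 2 := by
  rw [weightedSq, ← integral_const_mul, ← integral_const_mul]
  refine setIntegral_mono_on ((integrable_smoothWeight_mul_sq β hf).const_mul k)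
    (hf.integrable_sq.const_mul m) measurableSet_Ioo fun x hx => ?_
  rw [← mul_assoc]
  by_cases h0 : f x = 0
  · simp [h0]
  · exact mul_le_mul_of_nonneg_right (h x hx h0) (sq_nonneg _)

/-- The factor `d - a` is the point: on short intervals the zero-order term is negligible against
the derivative term. -/
theorem IsTestFunction.integral_sq_le {φ : ℝ → ℝ} (hφ : IsTestFunction φ) {a d : ℝ}
    (ha : 0 ≤ a) (hab : a ≤ d) (hd : d ≤ 1) (hs : Function.support φ ⊆ Ioo a d) :
    ∫ x in Ioo (0 : ℝ) 1, φ x ^ 2 ≤ (d - a) * ∫ x in Ioo (0 : ℝ) 1, _root_.deriv φ x ^ 2 := by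
  have hle : ∀ x ∈ Ioo a d, φ x ^ 2 ≤ ∫ x in Ioo (0 : ℝ) 1, _root_.deriv φ x ^ 2 := by
    intro x hx
    have := prim_sq_le hφ.deriv.memLp (Ioo_subset_Icc_self (Ioo_subset_Ioo ha hd hx))
    rwa [hφ.prim_deriv] at this
  have e : ∫ x in Ioo (0 : ℝ) 1, φ x ^ 2 = ∫ x in Ioo a d, φ x ^ 2 :=
    (setIntegral_eq_of_subset_of_forall_sdiff_eq_zero measurableSet_Ioo (Ioo_subset_Ioo ha hd)
      fun x hx => by
        rw [Function.notMem_support.1 fun h => hx.2 (hs h), zero_pow two_ne_zero])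
  rw [e]
  refine (setIntegral_mono_on (IntegrableOn.mono_set hφ.memLp.integrable_sq
    (Ioo_subset_Ioo ha hd)) (integrable_const _) measurableSet_Ioo hle).trans_eq ?_
  rw [integral_const, measureReal_restrict_apply_univ, Real.volume_real_Ioo_of_le hab, smul_eq_mul]

/-- A bump concentrated near `c` lets the derivative term, of negative sign there, dominate. For `b
= 3` that term disappears and the zero-order term alone is negative. -/
theorem exists_quadForm_neg {b β c : ℝ} (hc : c ∈ Ioo (0 : ℝ) 1)
    (h : (3 - b) * smoothWeight β c < 0 ∨ b = 3 ∧ smoothWeight β c < 0) :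
    ∃ φ, IsTestFunction φ ∧ quadForm b β φ (deriv φ) < 0 := by
  obtain ⟨M₀, hM₀, hM⟩ := exists_abs_smoothWeight_le β
  have near : ∀ k : ℝ, k * smoothWeight β c < 0 → ∃ m > 0, ∃ a d, 0 < a ∧ a < d ∧
      d < 1 ∧ (d - a) * (|b| * M₀) < m ∧ ∀ x ∈ Icc a d, k * smoothWeight β x ≤ -m := by
    intro k hk
    set m := -(k * smoothWeight β c) / 2 with hm
    have hm0 : 0 < m := by linarith
    have hopen : IsOpen {x | k * smoothWeight β x < -m} :=
      isOpen_lt (continuous_const.mul (continuous_smoothWeight β)) continuous_const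
    obtain ⟨ρ, hρ, hball⟩ := Metric.isOpen_iff.1 hopen c
      (show k * smoothWeight β c < -m by linarith)
    obtain ⟨hc0, hc1⟩ := hc
    set q := |b| * M₀ + 1 with hq
    have hq0 : 0 < q := by positivity
    -- The bound `ρ` keeps the interval in the region of negative sign, `m / (2 * q)` makes its
    -- length `2 * r` beat `|b| * M₀`, and `min c (1 - c)` keeps it inside `(0,1)`. The `+ 1` in `q`
    -- covers `b = 0`.
    obtain ⟨r, hr, hrlt⟩ := exists_between (show (0 : ℝ) < min (min ρ (m / (2 * q)))
      (min c (1 - c)) by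
        have := sub_pos.2 hc1
        positivity)
    simp only [lt_min_iff] at hrlt
    obtain ⟨⟨hr1, hr2⟩, hr3, hr4⟩ := hrlt
    rw [lt_div_iff₀ (by positivity)] at hr2
    refine ⟨m, hm0, c - r, c + r, by linarith, by linarith, by linarith, ?_, fun x hx => ?_⟩
    · nlinarith
    · refine (hball (a := x) ?_).le
      rw [Metric.mem_ball, Real.dist_eq, abs_lt]
      constructor <;> linarith [hx.1, hx.2]
  rcases h with h | ⟨rfl, h⟩
  · obtain ⟨m, hm, a, d, ha, had, hd, hlt, hle⟩ := near _ h
    obtain ⟨φ, hφ, hs, -⟩ := exists_isTestFunction_support_subset ha had hd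
    refine ⟨φ, hφ, ?_⟩
    have h1 := weightedSq_mul_le (β := β) (k := b) (m := |b| * M₀) hφ.memLp fun x hx _ => by
      refine (le_abs_self _).trans ?_
      rw [abs_mul]
      exact mul_le_mul_of_nonneg_left (hM x (Ioo_subset_Icc_self hx)) (abs_nonneg b)
    have h2 := weightedSq_mul_le (β := β) (k := 3 - b) (m := -m) hφ.deriv.memLp fun x _ hx =>
      hle x (closure_minimal (hs.le.trans Ioo_subset_Icc_self) isClosed_Icc
        (support_deriv_subset hx))
    have h3 := hφ.integral_sq_le ha.le had.le hd.le hs.le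
    have h4 : 0 < ∫ x in Ioo (0 : ℝ) 1, φ x ^ 2 := integral_sq_pos ha.le had hd.le hφ.memLp
      fun x hx => by rwa [← Function.mem_support, hs]
    have h5 : 0 < ∫ x in Ioo (0 : ℝ) 1, deriv φ x ^ 2 :=
      pos_of_mul_pos_right (h4.trans_le h3) (by linarith)
    have h6 := mul_le_mul_of_nonneg_left h3 (show 0 ≤ |b| * M₀ by positivity)
    have h7 := mul_lt_mul_of_pos_right hlt h5
    rw [quadForm]
    linarith
  · obtain ⟨m, hm, a, d, ha, had, hd, -, hle⟩ := near 1 (by linarith)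
    obtain ⟨φ, hφ, hs, -⟩ := exists_isTestFunction_support_subset ha had hd
    refine ⟨φ, hφ, ?_⟩
    have h1 := weightedSq_mul_le (β := β) (k := 1) (m := -m) hφ.memLp fun x _ hx =>
      hle x (Ioo_subset_Icc_self (hs.le hx))
    have h4 : 0 < ∫ x in Ioo (0 : ℝ) 1, φ x ^ 2 := integral_sq_pos ha.le had hd.le hφ.memLp
      fun x hx => by rwa [← Function.mem_support, hs]
    have := mul_pos hm h4
    rw [quadForm]
    linarith

theorem abs_le_betaMax_of_bot_lt_J {b β : ℝ} (h : ⊥ < J b β) : |β| ≤ betaMax := by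
  by_contra! hβ
  obtain ⟨c, hc, hc'⟩ : ∃ c ∈ Ioo (0 : ℝ) 1,
      (3 - b) * smoothWeight β c < 0 ∨ b = 3 ∧ smoothWeight β c < 0 := by
    rcases lt_trichotomy b 3 with hb | hb | hb
    · obtain ⟨c, hc, hlt⟩ := exists_smoothWeight_lt_zero hβ
      exact ⟨c, hc, .inl (mul_neg_of_pos_of_neg (by linarith) hlt)⟩
    · obtain ⟨c, hc, hlt⟩ := exists_smoothWeight_lt_zero hβ
      exact ⟨c, hc, .inr ⟨hb, hlt⟩⟩
    · obtain ⟨c, hc, hlt⟩ := exists_smoothWeight_pos β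
      exact ⟨c, hc, .inl (mul_neg_of_neg_of_pos (by linarith) hlt)⟩
  obtain ⟨φ, hφ, hneg⟩ := exists_quadForm_neg hc hc'
  exact hneg.not_ge (quadForm_nonneg_of_bot_lt_J h hφ)

theorem le_three_of_bot_lt_J {b β : ℝ} (h : ⊥ < J b β) : b ≤ 3 := by
  by_contra! hb
  obtain ⟨c, hc, hlt⟩ := exists_smoothWeight_pos β
  obtain ⟨φ, hφ, hneg⟩ := exists_quadForm_neg hc
    (.inl (mul_neg_of_neg_of_pos (sub_neg.2 hb) hlt))
  exact hneg.not_ge (quadForm_nonneg_of_bot_lt_J h hφ)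

/-! ### Strictness of the threshold at the best constant. -/

/-- A smooth substitute for `|φ|`. -/
def smoothAbs (ε : ℝ) (φ : ℝ → ℝ) (x : ℝ) : ℝ := √(φ x ^ 2 + ε ^ 2) - ε

section smoothAbs

variable {ε : ℝ} {φ : ℝ → ℝ}

theorem IsTestFunction.smoothAbs (hφ : IsTestFunction φ) (hε : 0 < ε) :
    IsTestFunction (smoothAbs ε φ) := by
  obtain ⟨a, b, ha, -, hb, hs⟩ := hφ.exists_support_subset
  refine .of_support_subset ?_ ha hb (Subset.trans (?_ : _ ⊆ Function.support φ) hs)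
  · refine ContDiff.sub (ContDiff.sqrt ((hφ.contDiff.pow 2).add contDiff_const) fun x => ?_)
      contDiff_const
    positivity
  · refine fun x hx h0 => hx ?_
    simp [BFamily.smoothAbs, h0, Real.sqrt_sq hε.le]

theorem smoothAbs_nonneg (x : ℝ) : 0 ≤ smoothAbs ε φ x :=
  sub_nonneg.2 (Real.le_sqrt_of_sq_le (by linarith [sq_nonneg (φ x)]))

theorem smoothAbs_le_abs (hε : 0 < ε) (x : ℝ) : smoothAbs ε φ x ≤ |φ x| := by
  rw [smoothAbs, sub_le_iff_le_add, Real.sqrt_le_left (by positivity)]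
  nlinarith [sq_abs (φ x), mul_nonneg (abs_nonneg (φ x)) hε.le]

theorem abs_sub_le_smoothAbs (x : ℝ) : |φ x| - ε ≤ smoothAbs ε φ x :=
  sub_le_sub_right (Real.abs_le_sqrt (by linarith [sq_nonneg ε])) ε

theorem smoothAbs_sq (x : ℝ) :
    smoothAbs ε φ x ^ 2 = φ x ^ 2 - 2 * ε * smoothAbs ε φ x := by
  have := Real.sq_sqrt (show 0 ≤ φ x ^ 2 + ε ^ 2 by positivity)
  rw [smoothAbs]
  linear_combination this

theorem deriv_smoothAbs_sq_le (hφ : Differentiable ℝ φ) (hε : 0 < ε) (x : ℝ) :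
    deriv (smoothAbs ε φ) x ^ 2 ≤ deriv φ x ^ 2 := by
  have hpos : 0 < φ x ^ 2 + ε ^ 2 := by positivity
  have hd : HasDerivAt (smoothAbs ε φ) (φ x * deriv φ x / √(φ x ^ 2 + ε ^ 2)) x := by
    have := (((hφ x).hasDerivAt.pow 2).add_const (ε ^ 2)).sqrt hpos.ne' |>.sub_const ε
    have hs := (Real.sqrt_pos.2 hpos).ne'
    refine this.congr_deriv ?_
    simp only [Pi.pow_apply, Nat.cast_ofNat, Nat.add_one_sub_one, pow_one]
    field_simp
  rw [hd.deriv, div_pow, Real.sq_sqrt hpos.le, div_le_iff₀ hpos]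
  nlinarith [sq_nonneg (ε * deriv φ x)]

end smoothAbs

theorem integrable_mul_of_isTestFunction {φ : ℝ → ℝ} (β : ℝ) (hφ : IsTestFunction φ) :
    Integrable (fun x => smoothWeight β x * φ x) unitMeasure :=
  integrable_smoothWeight_mul β (hφ.memLp.integrable one_le_two)

theorem integrable_mul_abs_of_isTestFunction {φ : ℝ → ℝ} (β : ℝ) (hφ : IsTestFunction φ) :
    Integrable (fun x => smoothWeight β x * |φ x|) unitMeasure :=
  integrable_smoothWeight_mul β (hφ.memLp.integrable one_le_two).abs

theorem weightedIntegral_nonneg {β : ℝ} (hβ : |β| ≤ betaMax) {f : ℝ → ℝ} (hf : ∀ x, 0 ≤ f x) :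
    0 ≤ weightedIntegral β f :=
  setIntegral_nonneg measurableSet_Ioo fun x hx => mul_nonneg (smoothWeight_pos hβ hx).le (hf x)

/-- Cancellation could make `∫ w φ` small for free. Applying the hypothesis to `smoothAbs ε φ`,
which has no larger derivative, and letting `ε → 0` removes it. -/
theorem sq_weightedIntegral_abs_le {β C K : ℝ} (hβ : |β| ≤ betaMax) (hC : 0 ≤ C) (hK : 0 ≤ K)
    (h : ∀ ψ, IsTestFunction ψ →
      weightedIntegral β ψ ^ 2 ≤ K * (C * weightedSq β (deriv ψ) - weightedSq β ψ))
    {φ : ℝ → ℝ} (hφ : IsTestFunction φ) :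
    weightedIntegral β (fun x => |φ x|) ^ 2
      ≤ K * (C * weightedSq β (deriv φ) - weightedSq β φ) := by
  set A := weightedIntegral β (fun x => |φ x|) with hA
  set w₀ := weightedIntegral β (fun _ => 1) with hw₀
  have hi := integrable_mul_abs_of_isTestFunction β hφ
  have h1 := integrable_smoothWeight_mul β (integrable_const (μ := unitMeasure) (1 : ℝ))
  have hA0 : 0 ≤ A := weightedIntegral_nonneg hβ fun x => abs_nonneg _
  have hw0 : 0 ≤ w₀ := weightedIntegral_nonneg hβ fun x => zero_le_one
  have key : ∀ ε, 0 < ε → A ^ 2 ≤ K * (C * weightedSq β (deriv φ) - weightedSq β φ + 2 * ε * A)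
      + 2 * ε * w₀ * A + ε ^ 2 * w₀ ^ 2 := by
    intro ε hε
    have hψ := hφ.smoothAbs hε
    have hψi := integrable_mul_of_isTestFunction β hψ
    set L := weightedIntegral β (smoothAbs ε φ) with hL
    have hL0 : 0 ≤ L := weightedIntegral_nonneg hβ smoothAbs_nonneg
    have hLA : L ≤ A := setIntegral_mono_on hψi hi measurableSet_Ioo fun x hx =>
      mul_le_mul_of_nonneg_left (smoothAbs_le_abs hε x) (smoothWeight_pos hβ hx).le
    have hAL : A ≤ L + ε * w₀ := by
      rw [hA, hL, hw₀, weightedIntegral, weightedIntegral, weightedIntegral, ← integral_const_mul,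
        ← integral_add hψi (h1.const_mul ε)]
      refine setIntegral_mono_on hi (hψi.add (h1.const_mul ε)) measurableSet_Ioo fun x hx => ?_
      have := mul_le_mul_of_nonneg_left (abs_sub_le_smoothAbs (ε := ε) (φ := φ) x)
        (smoothWeight_pos hβ hx).le
      linarith
    have hd : weightedSq β (deriv (smoothAbs ε φ)) ≤ weightedSq β (deriv φ) :=
      setIntegral_mono_on (integrable_smoothWeight_mul_sq β hψ.deriv.memLp)
        (integrable_smoothWeight_mul_sq β hφ.deriv.memLp) measurableSet_Ioo fun x hx =>
          mul_le_mul_of_nonneg_left (deriv_smoothAbs_sq_le hφ.differentiable hε x)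
            (smoothWeight_pos hβ hx).le
    have hs : weightedSq β (smoothAbs ε φ) = weightedSq β φ - 2 * ε * L := by
      rw [hL, weightedIntegral, weightedSq, weightedSq, ← integral_const_mul,
        ← integral_sub (integrable_smoothWeight_mul_sq β hφ.memLp) (hψi.const_mul (2 * ε))]
      congr 1 with x
      rw [smoothAbs_sq]
      ring
    have hh := h _ hψ
    rw [hs] at hh
    have h2 : A ^ 2 ≤ (L + ε * w₀) ^ 2 := pow_le_pow_left₀ hA0 hAL 2
    have h3 : K * (C * weightedSq β (deriv (smoothAbs ε φ)) - (weightedSq β φ - 2 * ε * L))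
        ≤ K * (C * weightedSq β (deriv φ) - weightedSq β φ + 2 * ε * A) := by
      refine mul_le_mul_of_nonneg_left ?_ hK
      have h4 := mul_le_mul_of_nonneg_left hd hC
      have h5 := mul_le_mul_of_nonneg_left hLA hε.le
      linarith
    have h6 := mul_le_mul_of_nonneg_left hLA (show 0 ≤ 2 * ε * w₀ by positivity)
    linarith [show (L + ε * w₀) ^ 2 = L ^ 2 + 2 * ε * w₀ * L + ε ^ 2 * w₀ ^ 2 by ring]
  have := le_apply_zero_of_forall_pos (F := fun ε =>
    K * (C * weightedSq β (deriv φ) - weightedSq β φ + 2 * ε * A)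
      + 2 * ε * w₀ * A + ε ^ 2 * w₀ ^ 2) (by fun_prop) key
  simpa using this

/-- In the two boundary layers, of total length `2 * δ`, the pointwise bound `w φ² ≤ 2A` is used
directly. In the middle `w ≥ m` turns it into a sup bound on `|φ|`, which is taken out of one factor
of `φ²`. -/
theorem IsTestFunction.weightedSq_le_add {β δ m : ℝ} (hβ : |β| ≤ betaMax) (hδ : 0 < δ)
    (hδ' : δ < 1 / 2) (hm : 0 < m) (hmle : ∀ x ∈ Icc δ (1 - δ), m ≤ smoothWeight β x)
    {φ : ℝ → ℝ} (hφ : IsTestFunction φ) :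
    weightedSq β φ ≤ 4 * δ * weightedSq β (_root_.deriv φ)
      + √(2 * weightedSq β (_root_.deriv φ) / m) * weightedIntegral β (fun x => |φ x|) := by
  set A := weightedSq β (_root_.deriv φ) with hA
  have hA0 : 0 ≤ A := weightedSq_nonneg hβ _
  have hi := integrable_mul_abs_of_isTestFunction β hφ
  have hsub : Icc δ (1 - δ) ⊆ Ioo 0 1 := Icc_subset_Ioo hδ (by linarith)
  have hind : Integrable ((Ioo 0 1 \ Icc δ (1 - δ)).indicator fun _ => 2 * A) unitMeasure :=
    (integrable_const _).indicator (measurableSet_Ioo.diff measurableSet_Icc)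
  have e : ∫ x in Ioo (0 : ℝ) 1, (Ioo 0 1 \ Icc δ (1 - δ)).indicator (fun _ => 2 * A) x
      = 4 * δ * A := by
    rw [setIntegral_indicator (measurableSet_Ioo.diff measurableSet_Icc), setIntegral_const,
      inter_eq_right.2 sdiff_subset, measureReal_sdiff hsub measurableSet_Icc (by simp),
      Real.volume_real_Ioo_of_le zero_le_one, Real.volume_real_Icc_of_le (by linarith),
      smul_eq_mul]
    ring
  rw [← e, weightedIntegral, ← integral_const_mul, ← integral_add hind (hi.const_mul _)]
  refine setIntegral_mono_on (integrable_smoothWeight_mul_sq β hφ.memLp)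
    (hind.add (hi.const_mul _)) measurableSet_Ioo fun x hx => ?_
  have hw := (smoothWeight_pos hβ hx).le
  have hpt := hφ.smoothWeight_mul_sq_le hβ (Ioo_subset_Icc_self hx)
  by_cases hxδ : x ∈ Icc δ (1 - δ)
  · rw [indicator_of_notMem (fun h => h.2 hxδ), zero_add]
    have h1 : |φ x| ≤ √(2 * A / m) := by
      refine Real.abs_le_sqrt ((le_div_iff₀ hm).2 ?_)
      have := mul_le_mul_of_nonneg_right (hmle x hxδ) (sq_nonneg (φ x))
      linarith
    have h2 := mul_le_mul_of_nonneg_left h1 (mul_nonneg hw (abs_nonneg (φ x)))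
    have h3 := sq_abs (φ x)
    calc smoothWeight β x * φ x ^ 2 = smoothWeight β x * |φ x| * |φ x| := by rw [← h3]; ring
      _ ≤ _ := h2.trans_eq (by ring)
  · rw [indicator_of_mem (show x ∈ Ioo 0 1 \ Icc δ (1 - δ) from ⟨hx, hxδ⟩)]
    have := mul_nonneg (Real.sqrt_nonneg (2 * A / m)) (mul_nonneg hw (abs_nonneg (φ x)))
    linarith

/-- At the optimal constant, the defect of the Poincaré inequality does not control the mean. -/
theorem not_forall_sq_weightedIntegral_le {β K : ℝ} (hβ : |β| ≤ betaMax) (hK : 0 ≤ K) :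
    ¬ ∀ ψ, IsTestFunction ψ → weightedIntegral β ψ ^ 2 ≤
      K * (poincareConst β * weightedSq β (deriv ψ) - weightedSq β ψ) := by
  intro h
  set C := poincareConst β with hC
  have hC0 : 0 < C := poincareConst_pos hβ
  -- With `4 * δ ≤ C / 2`, the limit `η → 0` of `key` reads `C ≤ 4 * δ` and contradicts `C > 0`.
  set δ := min (C / 8) (1 / 4) with hδ
  have hδ0 : 0 < δ := by positivity
  have hδ1 : δ ≤ C / 8 := min_le_left _ _
  have hδ2 : δ ≤ 1 / 4 := min_le_right _ _
  obtain ⟨m, hm, hmle⟩ := exists_le_smoothWeight (β := β) (isCompact_Icc (a := δ) (b := 1 - δ))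
    fun x hx => smoothWeight_pos hβ (Icc_subset_Ioo hδ0 (by linarith) hx)
  have key : ∀ η, 0 < η → C ≤ η + 4 * δ + √(2 / m * (K * η)) := by
    intro η hη
    rcases le_or_gt C η with hCη | hCη
    · have := Real.sqrt_nonneg (2 / m * (K * η))
      linarith
    have hnot : C - η ∉ poincareConstants β := fun hmem => by
      have := (isLeast_poincareConst hβ).2 hmem
      linarith
    rw [mem_poincareConstants_iff hβ] at hnot
    push Not at hnot
    -- A nearly extremal `φ`: its defect is below `η * A`, so the mean of `|φ|` is at most `√(K * (η
    -- * A))`.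
    obtain ⟨φ, hφ, hlt⟩ := hnot (sub_pos.2 hCη)
    set A := weightedSq β (deriv φ) with hA
    have hA0 : 0 < A := by
      refine lt_of_le_of_ne (weightedSq_nonneg hβ _) fun h0 => ?_
      have := hφ.weightedSq_le hβ
      rw [← hA, ← h0] at this
      rw [← h0] at hlt
      linarith
    have h1 := sq_weightedIntegral_abs_le hβ hC0.le hK h hφ
    have h2 : weightedIntegral β (fun x => |φ x|) ≤ √(K * (η * A)) := by
      refine Real.le_sqrt_of_sq_le (h1.trans (mul_le_mul_of_nonneg_left ?_ hK))
      linarith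
    have h3 := hφ.weightedSq_le_add hβ hδ0 (by linarith) hm hmle
    have h4 : √(2 * A / m) * √(K * (η * A)) = A * √(2 / m * (K * η)) := by
      rw [← Real.sqrt_mul (by positivity), show 2 * A / m * (K * (η * A))
        = A ^ 2 * (2 / m * (K * η)) by ring, Real.sqrt_mul (sq_nonneg A), Real.sqrt_sq hA0.le]
    have h5 := mul_le_mul_of_nonneg_left h2 (Real.sqrt_nonneg (2 * A / m))
    rw [h4] at h5
    have h6 : A * (C - η) ≤ A * (4 * δ + √(2 / m * (K * η))) := by linarith
    linarith [le_of_mul_le_mul_left h6 hA0]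
  have := le_apply_zero_of_forall_pos (F := fun η => η + 4 * δ + √(2 / m * (K * η)))
    (by fun_prop) key
  simp only [mul_zero, Real.sqrt_zero] at this
  linarith

/-- If the inequality failed, `b` would be negative and `(3 - b) / -b` at most the best constant.
Nonnegativity of the form makes this ratio a Poincaré constant itself, so the two agree. The form is
then a multiple of the Poincaré defect and would control the mean, which is impossible. -/
theorem neg_one_div_poincareConst_lt_of_bot_lt_J {b β : ℝ} (h : ⊥ < J b β) (hb : b < 3) :
    -(1 / poincareConst β) < b / (3 - b) := by
  have hβ := abs_le_betaMax_of_bot_lt_J h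
  have hC := poincareConst_pos hβ
  by_contra! hle
  have hb3 : 0 < 3 - b := by linarith
  have hb0 : b < 0 := by
    by_contra! hb0
    have := div_nonneg hb0 hb3.le
    have := one_div_pos.2 hC
    linarith
  have hle' : (3 - b) / -b ≤ poincareConst β := by
    rw [div_le_iff₀ (by linarith)]
    rw [div_le_iff₀ hb3] at hle
    have := mul_le_mul_of_nonneg_left hle hC.le
    have e : poincareConst β * (-(1 / poincareConst β) * (3 - b)) = -(3 - b) := by
      field_simp
    linarith
  have hquad : ∀ φ : ℝ → ℝ, quadForm b β φ (deriv φ)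
      = -b / 2 * ((3 - b) / -b * weightedSq β (deriv φ) - weightedSq β φ) := by
    intro φ
    rw [quadForm]
    have := hb0.ne
    field_simp
    ring
  have hmem : (3 - b) / -b ∈ poincareConstants β := by
    refine (mem_poincareConstants_iff hβ).2 ⟨div_pos hb3 (by linarith), fun φ hφ => ?_⟩
    have := quadForm_nonneg_of_bot_lt_J h hφ
    rw [hquad] at this
    linarith [nonneg_of_mul_nonneg_right this (by linarith)]
  have heq : (3 - b) / -b = poincareConst β :=
    le_antisymm hle' ((isLeast_poincareConst hβ).2 hmem)
  obtain ⟨K, hK, hKle⟩ := exists_sq_weightedIntegral_le_of_bot_lt_J h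
  refine not_forall_sq_weightedIntegral_le hβ (K := K * (-b / 2) / b ^ 2)
    (div_nonneg (mul_nonneg hK.le (by linarith)) (sq_nonneg b)) fun ψ hψ => ?_
  have := hKle ψ hψ
  rw [hquad, heq, mul_pow] at this
  rw [div_mul_eq_mul_div, le_div_iff₀ (pow_pos (neg_pos.2 hb0) 2 |>.trans_eq (neg_sq b))]
  linarith

/-! ### Sufficiency: coercivity and the lower bound. -/

/-- For `b ≥ 0` the zero-order term is dropped. For `b < 0` the Poincaré inequality absorbs it,
leaving a coefficient whose positivity is condition 3. -/
theorem exists_mul_weightedSq_le_quadForm {b β : ℝ} (hβ : |β| ≤ betaMax) (hb : b < 3)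
    (h : -(1 / poincareConst β) < b / (3 - b)) :
    ∃ κ, 0 < κ ∧ ∀ g, MemLp g 2 unitMeasure → ∫ t in (0 : ℝ)..1, g t = 0 →
      κ * weightedSq β g ≤ quadForm b β (prim g) g := by
  have hC := poincareConst_pos hβ
  rcases le_or_gt 0 b with hb0 | hb0
  · refine ⟨(3 - b) / 2, by linarith, fun g hg _ => ?_⟩
    have := mul_nonneg hb0 (weightedSq_nonneg hβ (prim g))
    rw [quadForm]
    linarith
  · refine ⟨(b * poincareConst β + (3 - b)) / 2, ?_, fun g hg h0 => ?_⟩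
    · rw [lt_div_iff₀ (by linarith)] at h
      have := mul_lt_mul_of_pos_left h hC
      have e : poincareConst β * (-(1 / poincareConst β) * (3 - b)) = -(3 - b) := by
        field_simp
      linarith
    · have := mul_le_mul_of_nonpos_left (weightedSq_prim_le hβ hg h0) hb0.le
      rw [quadForm]
      linarith

theorem exists_le_energy {b β : ℝ} (hβ : |β| ≤ betaMax) (hb : b ≤ 3)
    (h : b < 3 → -(1 / poincareConst β) < b / (3 - b)) :
    ∃ m : ℝ, ∀ u g, Admissible u g → m ≤ energy b β u g := by
  rcases hb.eq_or_lt with rfl | hb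
  · refine ⟨0, fun u g hug => ?_⟩
    rw [energy_eq _ _ hug.1.2.1 hug.memLp_deriv]
    linarith [weightedSq_nonneg hβ u]
  obtain ⟨κ, hκ, hκle⟩ := exists_mul_weightedSq_le_quadForm hβ hb (h hb)
  have hC := poincareConst_pos hβ
  -- By Poincaré, the coercive term `κ ∫ w g²` dominates `τ ∫ w v²`, which is what completing the
  -- square against `b ∫ w v` consumes.
  set τ := κ / poincareConst β with hτ
  have hτ0 : 0 < τ := by positivity
  refine ⟨b / 2 * weightedSq β (fun _ => 1) - b ^ 2 / (4 * τ) * weightedSq β (fun _ => 1),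
    fun u g hug => ?_⟩
  have hg := hug.memLp_deriv
  have hp := memLp_prim hg
  have h0 := hug.integral_deriv_eq_zero
  rw [hug.energy_eq, energy_one_add b β hp hg]
  have h1 : 0 ≤ b * weightedIntegral β (prim g) + τ * weightedSq β (prim g)
      + b ^ 2 / (4 * τ) * weightedSq β (fun _ => 1) := by
    have i1 := (integrable_smoothWeight_mul β (hp.integrable one_le_two)).const_mul b
    have i2 := (integrable_smoothWeight_mul_sq β hp).const_mul τ
    have i3 := (integrable_smoothWeight_mul_sq β
      (memLp_const (μ := unitMeasure) (p := 2) (1 : ℝ))).const_mul (b ^ 2 / (4 * τ))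
    have i12 : Integrable (fun x => b * (smoothWeight β x * prim g x)
      + τ * (smoothWeight β x * prim g x ^ 2)) unitMeasure := i1.add i2
    rw [weightedIntegral, weightedSq, weightedSq, ← integral_const_mul, ← integral_const_mul,
      ← integral_const_mul, ← integral_add i1 i2, ← integral_add i12 i3]
    refine setIntegral_nonneg measurableSet_Ioo fun x hx => ?_
    have e : b * (smoothWeight β x * prim g x) + τ * (smoothWeight β x * prim g x ^ 2)
        + b ^ 2 / (4 * τ) * (smoothWeight β x * 1 ^ 2)
        = smoothWeight β x * (τ * (prim g x + b / (2 * τ)) ^ 2) := by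
      field_simp
      ring
    rw [e]
    exact mul_nonneg (smoothWeight_pos hβ hx).le (by positivity)
  have h2 := mul_le_mul_of_nonneg_left (weightedSq_prim_le hβ hg h0) hτ0.le
  have h3 : τ * (poincareConst β * weightedSq β g) = κ * weightedSq β g := by
    rw [hτ]
    field_simp
  linarith [hκle g hg h0]

/-! ### Attainment by the direct method in `L²`. -/

open Filter Topology in
/-- The direct method for uniformly convex functionals: every minimizing sequence is Cauchy. -/
theorem exists_forall_le_of_midpoint {H : Type*} [NormedAddCommGroup H] [NormedSpace ℝ H]
    [CompleteSpace H] {S : Set H} (hS : IsClosed S) (hne : S.Nonempty) {E : H → ℝ}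
    (hE : Continuous E) {c κ : ℝ} (hκ : 0 < κ) (hc : ∀ x ∈ S, c ≤ E x)
    (hmid : ∀ x ∈ S, ∀ y ∈ S, (1 / 2 : ℝ) • (x + y) ∈ S ∧
      E ((1 / 2 : ℝ) • (x + y)) + κ * ‖x - y‖ ^ 2 ≤ (E x + E y) / 2) :
    ∃ x ∈ S, ∀ y ∈ S, E x ≤ E y := by
  have hbdd : BddBelow (E '' S) := ⟨c, by rintro _ ⟨x, hx, rfl⟩; exact hc x hx⟩
  have hinf : ∀ y ∈ S, sInf (E '' S) ≤ E y := fun y hy => csInf_le hbdd (mem_image_of_mem E hy)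
  have hseq : ∀ n : ℕ, ∃ x ∈ S, E x < sInf (E '' S) + 1 / ((n : ℝ) + 1) := by
    intro n
    obtain ⟨_, ⟨x, hx, rfl⟩, hlt⟩ := exists_lt_of_csInf_lt (hne.image E)
      (lt_add_of_pos_right (sInf (E '' S)) (Nat.one_div_pos_of_nat (n := n) (α := ℝ)))
    exact ⟨x, hx, hlt⟩
  choose x hxS hx using hseq
  have hlim : Tendsto (fun n : ℕ => 1 / ((n : ℝ) + 1)) atTop (𝓝 0) :=
    tendsto_one_div_add_atTop_nhds_zero_nat
  have hcauchy : CauchySeq x := by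
    refine cauchySeq_of_le_tendsto_0 (fun N : ℕ => √(1 / ((N : ℝ) + 1) / κ))
      (fun n m N hn hm => ?_) ?_
    · obtain ⟨h1, h2⟩ := hmid _ (hxS n) _ (hxS m)
      rw [dist_eq_norm]
      refine Real.le_sqrt_of_sq_le ((le_div_iff₀ hκ).2 ?_)
      have h3 := hinf _ h1
      have h4 := Nat.one_div_le_one_div (α := ℝ) hn
      have h5 := Nat.one_div_le_one_div (α := ℝ) hm
      linarith [hx n, hx m]
    · have := (hlim.div_const κ).sqrt
      simpa using this
  obtain ⟨z, hz⟩ := cauchySeq_tendsto_of_complete hcauchy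
  refine ⟨z, hS.mem_of_tendsto hz (Eventually.of_forall hxS), fun y hy => ?_⟩
  refine le_trans ?_ (hinf y hy)
  have h1 : Tendsto (fun n => E (x n)) atTop (𝓝 (E z)) := (hE.tendsto z).comp hz
  have h2 := hlim.const_add (sInf (E '' S))
  rw [add_zero] at h2
  exact le_of_tendsto_of_tendsto' h1 h2 fun n => (hx n).le

theorem norm_sub_sq_eq_integral (F G : Lp ℝ 2 unitMeasure) :
    ‖F - G‖ ^ 2 = ∫ x in Ioo (0 : ℝ) 1, (F x - G x) ^ 2 := by
  rw [norm_sq_eq_integral]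
  refine integral_congr_ae ?_
  filter_upwards [Lp.coeFn_sub F G] with x hx
  rw [hx, Pi.sub_apply]

theorem abs_weightedSq_sub_le {β M η : ℝ} (hM : ∀ x ∈ Icc (0 : ℝ) 1, |smoothWeight β x| ≤ M)
    (hη : 0 < η) {f h : ℝ → ℝ} (hf : MemLp f 2 unitMeasure) (hh : MemLp h 2 unitMeasure) :
    |weightedSq β f - weightedSq β h| ≤ M * (η * (∫ x in Ioo (0 : ℝ) 1, h x ^ 2)
      + (1 + 1 / η) * ∫ x in Ioo (0 : ℝ) 1, (f x - h x) ^ 2) := by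
  have hd : MemLp (fun x => f x - h x) 2 unitMeasure := hf.sub hh
  have i1 := integrable_smoothWeight_mul_sq β hf
  have i2 := integrable_smoothWeight_mul_sq β hh
  have i3 := hh.integrable_sq.const_mul η
  have i4 := hd.integrable_sq.const_mul (1 + 1 / η)
  rw [weightedSq, weightedSq, ← integral_sub i1 i2, ← integral_const_mul, ← integral_const_mul,
    ← integral_add i3 i4, ← integral_const_mul]
  refine abs_integral_le_integral_abs.trans (setIntegral_mono_on (i1.sub i2).abs
    ((i3.add i4).const_mul M) measurableSet_Ioo fun x hx => ?_)
  rw [← mul_sub, abs_mul]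
  refine mul_le_mul (hM x (Ioo_subset_Icc_self hx)) ?_ (abs_nonneg _)
    ((abs_nonneg _).trans (hM x (Ioo_subset_Icc_self hx)))
  set d := f x - h x with hdx
  have e : f x ^ 2 - h x ^ 2 = d ^ 2 + 2 * (h x * d) := by rw [hdx]; ring
  have e1 : η * h x ^ 2 + (1 + 1 / η) * d ^ 2 - (d ^ 2 + 2 * (h x * d))
      = η * (h x - d / η) ^ 2 := by
    field_simp
    ring
  have e2 : η * h x ^ 2 + (1 + 1 / η) * d ^ 2 + (d ^ 2 + 2 * (h x * d))
      = η * (h x + d / η) ^ 2 + 2 * d ^ 2 := by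
    field_simp
    ring
  have p1 : 0 ≤ η * (h x - d / η) ^ 2 := by positivity
  have p2 : 0 ≤ η * (h x + d / η) ^ 2 + 2 * d ^ 2 := by positivity
  rw [e, abs_le]
  constructor <;> linarith

/-- The map `G` is left general to cover both `F` itself and `1 + prim F`. -/
theorem continuous_weightedSq (β : ℝ) {G : Lp ℝ 2 unitMeasure → ℝ → ℝ}
    (hG : ∀ F, MemLp (G F) 2 unitMeasure)
    (h : ∀ F F', ∫ x in Ioo (0 : ℝ) 1, (G F x - G F' x) ^ 2 ≤ ‖F - F'‖ ^ 2) :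
    Continuous fun F => weightedSq β (G F) := by
  obtain ⟨M, hM0, hM⟩ := exists_abs_smoothWeight_le β
  refine continuous_iff_continuousAt.2 fun F₀ => ?_
  rw [Metric.continuousAt_iff]
  intro ε hε
  have hI : 0 ≤ ∫ x in Ioo (0 : ℝ) 1, G F₀ x ^ 2 := integral_nonneg fun x => sq_nonneg _
  set I := ∫ x in Ioo (0 : ℝ) 1, G F₀ x ^ 2 with hIdef
  set η := ε / (2 * M * (I + 1)) with hη
  have hη0 : 0 < η := by positivity
  set q := M * (1 + 1 / η) with hq
  have hq0 : 0 < q := by positivity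
  refine ⟨√(ε / (2 * q)), Real.sqrt_pos.2 (by positivity), fun F hF => ?_⟩
  rw [dist_eq_norm, Real.lt_sqrt (norm_nonneg _), lt_div_iff₀ (by positivity)] at hF
  rw [Real.dist_eq]
  refine (abs_weightedSq_sub_le hM hη0 (hG F) (hG F₀)).trans_lt ?_
  have h1 := mul_le_mul_of_nonneg_left (h F F₀) hq0.le
  have h2 : M * (η * (I + 1)) = ε / 2 := by
    rw [hη]
    field_simp
  have h3 : 0 < M * η := by positivity
  rw [← hIdef, mul_add, ← mul_assoc M (1 + 1 / η), ← hq]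
  nlinarith

theorem prim_congr_ae {f g : ℝ → ℝ} (h : f =ᵐ[unitMeasure] g) :
    EqOn (prim f) (prim g) (Icc 0 1) := by
  intro x hx
  rw [prim, prim, intervalIntegral.integral_of_le hx.1, intervalIntegral.integral_of_le hx.1,
    integral_Ioc_eq_integral_Ioo, integral_Ioc_eq_integral_Ioo]
  exact integral_congr_ae (ae_restrict_of_ae_restrict_of_subset (Ioo_subset_Ioo_right hx.2) h)

theorem energy_congr_ae {f g : ℝ → ℝ} (b β : ℝ) (h : f =ᵐ[unitMeasure] g) :
    energy b β (fun x => 1 + prim f x) f = energy b β (fun x => 1 + prim g x) g := by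
  refine integral_congr_ae ?_
  filter_upwards [h, ae_restrict_mem measurableSet_Ioo] with x h1 h2
  rw [h1, prim_congr_ae h (Ioo_subset_Icc_self h2)]

theorem weightedSq_midpoint (β : ℝ) {f h : ℝ → ℝ} (hf : MemLp f 2 unitMeasure)
    (hh : MemLp h 2 unitMeasure) : weightedSq β (fun x => 1 / 2 * (f x + h x)) =
      (weightedSq β f + weightedSq β h) / 2 - 1 / 4 * weightedSq β (fun x => f x - h x) := by
  have hd : MemLp (fun x => f x - h x) 2 unitMeasure := hf.sub hh
  have i1 := integrable_smoothWeight_mul_sq β hf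
  have i2 := integrable_smoothWeight_mul_sq β hh
  have i3 := (integrable_smoothWeight_mul_sq β hd).const_mul (1 / 4)
  have i12 : Integrable (fun x => (smoothWeight β x * f x ^ 2 + smoothWeight β x * h x ^ 2) / 2)
    unitMeasure := (i1.add i2).div_const 2
  rw [weightedSq, weightedSq, weightedSq, weightedSq, ← integral_add i1 i2, ← integral_const_mul,
    ← integral_div, ← integral_sub i12 i3]
  congr 1 with x
  ring

theorem prim_midpoint {f h : ℝ → ℝ} (hf : MemLp f 2 unitMeasure) (hh : MemLp h 2 unitMeasure)
    {x : ℝ} (hx : x ∈ Icc (0 : ℝ) 1) :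
    prim (fun t => 1 / 2 * (f t + h t)) x = 1 / 2 * (prim f x + prim h x) := by
  have hs : uIcc 0 x ⊆ uIcc (0 : ℝ) 1 := by
    rw [uIcc_of_le hx.1, uIcc_of_le zero_le_one]
    exact Icc_subset_Icc_right hx.2
  simp only [prim]
  rw [intervalIntegral.integral_const_mul, intervalIntegral.integral_add
    ((intervalIntegrable_of_memLp hf).mono_set hs) ((intervalIntegrable_of_memLp hh).mono_set hs)]

/-- The parallelogram identity: the affine part `1` cancels in the difference, so the convexity gap
is the quadratic form of a mean-zero direction once both functions have the same mean. -/
theorem energy_midpoint (b β : ℝ) {f h : ℝ → ℝ} (hf : MemLp f 2 unitMeasure)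
    (hh : MemLp h 2 unitMeasure) :
    energy b β (fun x => 1 + prim (fun t => 1 / 2 * (f t + h t)) x)
        (fun x => 1 / 2 * (f x + h x))
      = (energy b β (fun x => 1 + prim f x) f + energy b β (fun x => 1 + prim h x) h) / 2
        - 1 / 4 * quadForm b β (prim fun x => f x - h x) (fun x => f x - h x) := by
  have hm : MemLp (fun x => 1 / 2 * (f x + h x)) 2 unitMeasure := (hf.add hh).const_mul _
  have one_add {k : ℝ → ℝ} (hk : MemLp k 2 unitMeasure) :
      MemLp (fun x => 1 + prim k x) 2 unitMeasure := (memLp_const (1 : ℝ)).add (memLp_prim hk)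
  have e1 : weightedSq β (fun x => 1 + prim (fun t => 1 / 2 * (f t + h t)) x)
      = weightedSq β (fun x => 1 / 2 * ((1 + prim f x) + (1 + prim h x))) :=
    weightedSq_congr β fun x hx => by
      simp only [prim_midpoint hf hh (Ioo_subset_Icc_self hx)]
      ring
  have e2 : weightedSq β (prim fun x => f x - h x)
      = weightedSq β (fun x => (1 + prim f x) - (1 + prim h x)) :=
    weightedSq_congr β fun x hx => by
      simp only [← prim_sub hf hh (Ioo_subset_Icc_self hx)]
      ring
  rw [energy_eq b β (one_add hm) hm, energy_eq b β (one_add hf) hf, energy_eq b β (one_add hh) hh,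
    e1, weightedSq_midpoint β (one_add hf) (one_add hh), weightedSq_midpoint β hf hh, quadForm, e2]
  ring

theorem exists_energy_eq_J {b β : ℝ} (hβ : |β| < betaMax) (hb : b < 3)
    (h : -(1 / poincareConst β) < b / (3 - b)) :
    ∃ u g : ℝ → ℝ, Admissible u g ∧ ((energy b β u g : ℝ) : EReal) = J b β := by
  obtain ⟨m, hm0, hm⟩ := exists_le_smoothWeight (β := β) (isCompact_Icc (a := 0) (b := 1))
    fun x hx => smoothWeight_pos_of_lt hβ hx
  obtain ⟨κ, hκ, hκle⟩ := exists_mul_weightedSq_le_quadForm hβ.le hb h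
  obtain ⟨c, hc⟩ := exists_le_energy hβ.le hb.le fun _ => h
  -- The problem is posed on the derivative: `S` encodes the boundary condition at 1, the one at 0
  -- being built into `1 + prim F`.
  let S : Set (Lp ℝ 2 unitMeasure) := {F | prim F 1 = 0}
  let E : Lp ℝ 2 unitMeasure → ℝ := fun F => energy b β (fun x => 1 + prim F x) F
  have hL : ∀ F : Lp ℝ 2 unitMeasure, MemLp F 2 unitMeasure := fun F => Lp.memLp F
  have hd : ∀ F G : Lp ℝ 2 unitMeasure, MemLp (fun x => F x - G x) 2 unitMeasure :=
    fun F G => (hL F).sub (hL G)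
  have h1mem : (1 : ℝ) ∈ Icc (0 : ℝ) 1 := ⟨zero_le_one, le_rfl⟩
  have hadm : ∀ F ∈ S, Admissible (fun x => 1 + prim F x) F :=
    fun F hF => admissible_one_add_prim (hL F) hF
  have hU : ∀ F : Lp ℝ 2 unitMeasure, MemLp (fun x => 1 + prim F x) 2 unitMeasure :=
    fun F => (memLp_const (1 : ℝ)).add (memLp_prim (hL F))
  have hS : IsClosed S := by
    have : LipschitzWith 1 fun F : Lp ℝ 2 unitMeasure => prim F 1 := by
      refine LipschitzWith.of_dist_le_mul fun F G => ?_
      rw [NNReal.coe_one, one_mul, Real.dist_eq, dist_eq_norm, prim_sub (hL F) (hL G) h1mem]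
      refine abs_le_of_sq_le_sq ?_ (norm_nonneg _)
      rw [norm_sub_sq_eq_integral]
      exact prim_sq_le (hd F G) h1mem
    exact isClosed_singleton.preimage this.continuous
  have hE : Continuous E := by
    have h1 : Continuous fun F : Lp ℝ 2 unitMeasure => weightedSq β (fun x => 1 + prim F x) := by
      refine continuous_weightedSq β hU fun F G => ?_
      rw [norm_sub_sq_eq_integral]
      refine le_trans (le_of_eq ?_) (integral_prim_sq_le (hd F G))
      refine setIntegral_congr_fun measurableSet_Ioo fun x hx => ?_
      simp only [add_sub_add_left_eq_sub, prim_sub (hL F) (hL G) (Ioo_subset_Icc_self hx)]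
    have h2 : Continuous fun F : Lp ℝ 2 unitMeasure => weightedSq β F :=
      continuous_weightedSq β hL fun F G => (norm_sub_sq_eq_integral F G).ge
    have e : E = fun F : Lp ℝ 2 unitMeasure => b / 2 * weightedSq β (fun x => 1 + prim F x)
        + (3 - b) / 2 * weightedSq β F := funext fun F => energy_eq b β (hU F) (hL F)
    rw [e]
    fun_prop
  have hmid : ∀ F ∈ S, ∀ G ∈ S, (1 / 2 : ℝ) • (F + G) ∈ S ∧
      E ((1 / 2 : ℝ) • (F + G)) + κ * m / 4 * ‖F - G‖ ^ 2 ≤ (E F + E G) / 2 := by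
    intro F hF G hG
    have hae : ((1 / 2 : ℝ) • (F + G) : Lp ℝ 2 unitMeasure) =ᵐ[unitMeasure]
        fun x => 1 / 2 * (F x + G x) := by
      filter_upwards [Lp.coeFn_smul (1 / 2 : ℝ) (F + G), Lp.coeFn_add F G] with x h1 h2
      rw [h1, Pi.smul_apply, h2, Pi.add_apply, smul_eq_mul]
    have hF' : prim F 1 = 0 := hF
    have hG' : prim G 1 = 0 := hG
    constructor
    · change prim _ 1 = 0
      rw [prim_congr_ae hae h1mem, prim_midpoint (hL F) (hL G) h1mem, hF', hG']
      simp
    · change energy b β _ _ + _ ≤ _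
      rw [energy_congr_ae b β hae, energy_midpoint b β (hL F) (hL G)]
      have h0 : ∫ t in (0 : ℝ)..1, (F t - G t) = 0 := by
        have := prim_sub (hL F) (hL G) h1mem
        rw [hF', hG', sub_zero] at this
        exact this.symm
      -- Coercivity bounds the convexity gap below by the weighted norm. The lower bound `m` on the
      -- weight, the only use of strict `|β| < betaMax`, turns that into the `L²` norm.
      have q1 := hκle _ (hd F G) h0
      have q2 : m * ‖F - G‖ ^ 2 ≤ weightedSq β (fun x => F x - G x) := by
        rw [norm_sub_sq_eq_integral, ← integral_const_mul]
        refine setIntegral_mono_on ((hd F G).integrable_sq.const_mul m)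
          (integrable_smoothWeight_mul_sq β (hd F G)) measurableSet_Ioo fun x hx => ?_
        exact mul_le_mul_of_nonneg_right (hm x (Ioo_subset_Icc_self hx)) (sq_nonneg _)
      have q3 := mul_le_mul_of_nonneg_left q2 hκ.le
      simp only [E]
      linarith
  have hne : S.Nonempty := by
    refine ⟨0, ?_⟩
    change prim _ 1 = 0
    rw [prim_congr_ae (Lp.coeFn_zero ℝ 2 unitMeasure) h1mem]
    simp [prim]
  obtain ⟨F, hF, hmin⟩ := exists_forall_le_of_midpoint hS hne hE
    (show 0 < κ * m / 4 by positivity) (fun F hF => hc _ _ (hadm F hF)) hmid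
  refine ⟨_, _, hadm F hF, le_antisymm (le_sInf ?_) (sInf_le ⟨_, _, hadm F hF, rfl⟩)⟩
  rintro _ ⟨u, g, hug, rfl⟩
  have hg := hug.memLp_deriv
  rw [EReal.coe_le_coe_iff, hug.energy_eq, ← energy_congr_ae b β hg.coeFn_toLp]
  refine hmin (hg.toLp g) ?_
  change prim _ 1 = 0
  rw [prim_congr_ae hg.coeFn_toLp h1mem]
  exact hug.integral_deriv_eq_zero

end BFamily

end

theorem mainTheorem2 (b β : ℝ) :
    (|β| ≤ BFamily.betaMax →
      IsLeast (BFamily.poincareConstants β) (BFamily.poincareConst β)) ∧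
    (⊥ < BFamily.J b β ↔
      |β| ≤ BFamily.betaMax ∧ b ≤ 3 ∧
        (b < 3 → -(1 / BFamily.poincareConst β) < b / (3 - b))) ∧
    (|β| < BFamily.betaMax → b < 3 → -(1 / BFamily.poincareConst β) < b / (3 - b) →
      ∃ u g : ℝ → ℝ, BFamily.Admissible u g ∧
        ((BFamily.energy b β u g : ℝ) : EReal) = BFamily.J b β) :=
  ⟨BFamily.isLeast_poincareConst,
    ⟨fun h => ⟨BFamily.abs_le_betaMax_of_bot_lt_J h, BFamily.le_three_of_bot_lt_J h,
      BFamily.neg_one_div_poincareConst_lt_of_bot_lt_J h⟩,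
      fun ⟨hβ, hb, h⟩ => BFamily.bot_lt_J_iff.2 (BFamily.exists_le_energy hβ hb h)⟩,
    BFamily.exists_energy_eq_J⟩
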